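/- Fix a countably infinite set of propositional letters, and let formulas be built with the primitive connectives $\neg,\vee,\Diamond$ (propositional modal formulas), or with $\neg,\vee,\Diamond,\exists$ (formulas of the bimodal language $\mathcal L_\exists$); $\wedge,\to,\Box=\neg\Diamond\neg,\forall=\neg\exists\neg$ are abbreviations. Let $\mathcal L_Q$ be the predicate modal language with countably infinitely many individual variables and, for each $n\ge 0$, countably infinitely many $n$-ary predicates, without equality, constants and function symbols, with primitive connectives $\neg,\vee,\Diamond,\exists x$; the propositional letters are identified with the $0$-ary predicates. Let $\mathbf K$ be the least normal modal logic, $\mathbf{GL}=\mathbf K+\Box(\Box p\to p)\to\Box p$, and $\mathbf{Grz}=\mathbf{S4}+\Box(\Box(p\to\Box p)\to p)\to p$. For a propositional modal logic $\mathbf L$, let $\mathbf{ML}$ be the least set of $\mathcal L_\exists$-formulas containing the theorems of $\mathbf L$, the $\mathbf{S5}$ axioms for $\exists$ and $\exists\Diamond p\to\Diamond\exists p$, and closed under modus ponens, $\Box$-necessitation, $\forall$-necessitation and uniform substitution; and let $\mathbf{QL}$ be the least set of $\mathcal L_Q$-formulas containing the axioms of the classical predicate calculus and the theorems of $\mathbf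 L$, and closed under modus ponens, $\Box$-necessitation, generalization ($\varphi\,/\,\forall x\varphi$) and (capture-free) uniform substitution of formulas for predicates. For a formula $\chi$, let $\mathbf{ML}+\chi$ and $\mathbf{QL}+\chi$ be the least extensions of $\mathbf{ML}$ and $\mathbf{QL}$ containing $\chi$ and closed under the respective rules. Put $$\mathbf M^+\mathbf{Grz}=\mathbf{MGrz}+\Box\forall(\Box(\Box p\to\Box\forall p)\to\Box\forall p)\to\Box\forall p,$$ $$\mathbf Q^+\mathbf{Grz}=\mathbf{QGrz}+\Box\forall x(\Box(\Box P(x)\to\Box\forall xP(x))\to\Box\forall xP(x))\to\Box\forall xP(x),$$ where $P$ is a unary predicate. Fix an individual variable $x$ and an injective assignment of a unary predicate $p^*$ to each propositional letter $p$. Define the translation $(-)^t$ from $\mathcal L_\exists$-formulas to $\mathcal L_Q$-formulas by $p^t=p^*(x)$, $(\varphi\vee\psi)^t=\varphi^t\vee\psi^t$, $(\neg\varphi)^t=\neg\varphi^t$, $(\Diamond\varphi)^t=\Diamond\varphi^t$, $(\exists\varphi)^t=\exists x\,\varphi^t$. A set $\mathbf M$ of $\mathcal L_\exists$-formulas is the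 monadic fragment of a set $\mathbf Q$ of $\mathcal L_Q$-formulas if for every $\mathcal L_\exists$-formula $\varphi$: $\varphi\in\mathbf M$ if and only if $\varphi^t\in\mathbf Q$. Then $\mathbf{MGL}$ is the monadic fragment of $\mathbf{QGL}$, and $\mathbf M^+\mathbf{Grz}$ is the monadic fragment of $\mathbf Q^+\mathbf{Grz}$. -/

import Mathlib

namespace MonadicModal

/-! ## Propositional modal logic -/

/-- Formulas of the propositional modal language, with letters `p_0, p_1, …` and
primitive connectives `¬`, `∨`, `◇`. -/
inductive PForm : Type
  | letter (p : ℕ) : PForm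
  | neg (φ : PForm) : PForm
  | or (φ ψ : PForm) : PForm
  | dia (φ : PForm) : PForm

namespace PForm

def imp (φ ψ : PForm) : PForm := or (neg φ) ψ
def and (φ ψ : PForm) : PForm := neg (or (neg φ) (neg ψ))
def iff (φ ψ : PForm) : PForm := and (imp φ ψ) (imp ψ φ)
def box (φ : PForm) : PForm := neg (dia (neg φ))

/-- Uniform substitution `φ[ψ/p]`. -/
def subst (p : ℕ) (ψ : PForm) : PForm → PForm
  | letter q => if q = p then ψ else letter q
  | neg φ => neg (subst p ψ φ)
  | or φ χ => or (subst p ψ φ) (subst p ψ χ)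
  | dia φ => dia (subst p ψ φ)

/-- Classical tautologies: true under every assignment of truth values to formulas that
respects `¬` and `∨`. -/
def IsTautology (φ : PForm) : Prop :=
  ∀ v : PForm → Prop, (∀ α, v (neg α) ↔ ¬ v α) → (∀ α β, v (or α β) ↔ (v α ∨ v β)) → v φ

end PForm

/-- The least set of propositional modal formulas containing `Γ` and closed under modus ponens,
necessitation and uniform substitution. -/
inductive PClosure (Γ : Set PForm) : Set PForm
  | base {φ : PForm} : φ ∈ Γ → PClosure Γ φ
  | mp {φ ψ : PForm} : PClosure Γ φ → PClosure Γ (φ.imp ψ) → PClosure Γ ψ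
  | nec {φ : PForm} : PClosure Γ φ → PClosure Γ φ.box
  | subst {φ : PForm} (p : ℕ) (ψ : PForm) : PClosure Γ φ → PClosure Γ (PForm.subst p ψ φ)

section PropositionalLogics
open PForm

/-- The least normal modal logic **K**. As `◇` is primitive, the duality between `◇` and `□`
is one of the axioms. -/
def logicK : Set PForm :=
  PClosure ({φ | φ.IsTautology} ∪
    {imp (box (imp (letter 0) (letter 1))) (imp (box (letter 0)) (box (letter 1))),
     iff (dia (letter 0)) (neg (box (neg (letter 0))))})

/-- **S4** `= K + (p → ◇p) + (◇◇p → ◇p)`. -/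
def logicS4 : Set PForm :=
  PClosure (logicK ∪
    {imp (letter 0) (dia (letter 0)), imp (dia (dia (letter 0))) (dia (letter 0))})

/-- **Grz** `= S4 + □(□(p → □p) → p) → p`. -/
def logicGrz : Set PForm :=
  PClosure (insert
    (imp (box (imp (box (imp (letter 0) (box (letter 0)))) (letter 0))) (letter 0)) logicS4)

/-- **GL** `= K + □(□p → p) → □p`. -/
def logicGL : Set PForm :=
  PClosure (insert
    (imp (box (imp (box (letter 0)) (letter 0))) (box (letter 0))) logicK)

end PropositionalLogics

/-! ## Monadic modal logic -/

/-- Formulas of the bimodal language with the modalities `◇` and `∃`. -/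
inductive MForm : Type
  | letter (p : ℕ) : MForm
  | neg (φ : MForm) : MForm
  | or (φ ψ : MForm) : MForm
  | dia (φ : MForm) : MForm
  | ex (φ : MForm) : MForm

namespace MForm

def imp (φ ψ : MForm) : MForm := or (neg φ) ψ
def and (φ ψ : MForm) : MForm := neg (or (neg φ) (neg ψ))
def iff (φ ψ : MForm) : MForm := and (imp φ ψ) (imp ψ φ)
def box (φ : MForm) : MForm := neg (dia (neg φ))
def all (φ : MForm) : MForm := neg (ex (neg φ))

/-- Uniform substitution `φ[ψ/p]`. -/
def subst (p : ℕ) (ψ : MForm) : MForm → MForm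
  | letter q => if q = p then ψ else letter q
  | neg φ => neg (subst p ψ φ)
  | or φ χ => or (subst p ψ φ) (subst p ψ χ)
  | dia φ => dia (subst p ψ φ)
  | ex φ => ex (subst p ψ φ)

/-- The propositional modal language as a part of the bimodal language. -/
def ofPForm : PForm → MForm
  | .letter p => letter p
  | .neg φ => neg (ofPForm φ)
  | .or φ ψ => or (ofPForm φ) (ofPForm ψ)
  | .dia φ => dia (ofPForm φ)

/-- The **S5** axioms for the modality `∃` (with dual `∀`). -/
def s5Ax : Set MForm :=
  {imp (all (imp (letter 0) (letter 1))) (imp (all (letter 0)) (all (letter 1))),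
   iff (ex (letter 0)) (neg (all (neg (letter 0)))),
   imp (letter 0) (ex (letter 0)),
   imp (ex (ex (letter 0))) (ex (letter 0)),
   imp (ex (letter 0)) (all (ex (letter 0)))}

/-- The connecting axiom `∃◇p → ◇∃p`. -/
def connecting : MForm := imp (ex (dia (letter 0))) (dia (ex (letter 0)))

/-- `□∀(□(□p → □∀p) → □∀p) → □∀p`. -/
def plusFormula : MForm :=
  imp
    (box (all (imp (box (imp (box (letter 0)) (box (all (letter 0))))) (box (all (letter 0))))))
    (box (all (letter 0)))

end MForm

/-- The least set of bimodal formulas containing `Γ` and closed under modus ponens,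
`□`-necessitation, `∀`-necessitation and uniform substitution. -/
inductive MClosure (Γ : Set MForm) : Set MForm
  | base {φ : MForm} : φ ∈ Γ → MClosure Γ φ
  | mp {φ ψ : MForm} : MClosure Γ φ → MClosure Γ (φ.imp ψ) → MClosure Γ ψ
  | boxNec {φ : MForm} : MClosure Γ φ → MClosure Γ φ.box
  | allNec {φ : MForm} : MClosure Γ φ → MClosure Γ φ.all
  | subst {φ : MForm} (p : ℕ) (ψ : MForm) : MClosure Γ φ → MClosure Γ (MForm.subst p ψ φ)

/-- The least monadic extension **ML** of a propositional modal logic **L**. -/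
def monadicExt (L : Set PForm) : Set MForm :=
  MClosure (MForm.ofPForm '' L ∪ MForm.s5Ax ∪ {MForm.connecting})

/-- **MGL**. -/
def MGL : Set MForm := monadicExt logicGL

/-- **M⁺Grz** `= MGrz + □∀(□(□p → □∀p) → □∀p) → □∀p`. -/
def MPlusGrz : Set MForm := MClosure (insert MForm.plusFormula (monadicExt logicGrz))

/-! ## Predicate modal logic -/

/-- Formulas of the predicate modal language. The individual variables are the natural numbers;
for each arity `n` there are predicates `P^n_0, P^n_1, …`, and `atom n k y` is
`P^n_k(y_1, …, y_n)`. There are no constants, function symbols or equality. -/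
inductive QForm : Type
  | atom (n k : ℕ) (y : Fin n → ℕ) : QForm
  | neg (φ : QForm) : QForm
  | or (φ ψ : QForm) : QForm
  | dia (φ : QForm) : QForm
  | ex (x : ℕ) (φ : QForm) : QForm

namespace QForm

def imp (φ ψ : QForm) : QForm := or (neg φ) ψ
def and (φ ψ : QForm) : QForm := neg (or (neg φ) (neg ψ))
def box (φ : QForm) : QForm := neg (dia (neg φ))
def all (x : ℕ) (φ : QForm) : QForm := neg (ex x (neg φ))

/-- Free variables. -/
def fv : QForm → Finset ℕ
  | atom _ _ y => Finset.univ.image y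
  | neg φ => fv φ
  | or φ ψ => fv φ ∪ fv ψ
  | dia φ => fv φ
  | ex x φ => (fv φ).erase x

/-- The bound variable used in place of `x` when the variables in `S` must not be captured:
`x` itself if possible, otherwise a variable outside `S`. -/
def avoid (S : Finset ℕ) (x : ℕ) : ℕ := if x ∈ S then S.sup id + 1 else x

/-- Every free occurrence of each variable `v` is replaced by `σ v`, bound variables being
renamed where this is needed to avoid capture. -/
def vsubst : (ℕ → ℕ) → QForm → QForm
  | σ, atom n k y => atom n k (σ ∘ y)
  | σ, neg φ => neg (vsubst σ φ)
  | σ, or φ ψ => or (vsubst σ φ) (vsubst σ ψ)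
  | σ, dia φ => dia (vsubst σ φ)
  | σ, ex x φ =>
      let z := avoid (((fv φ).erase x).image σ) x
      ex z (vsubst (Function.update σ x z) φ)

/-- Auxiliary recursion for `psubst`: `σ` is the renaming of variables in force. The atoms
`P^m_j(y)` become `ψ[σ(y)/x]`, and no bound variable of the formula under substitution is allowed
to capture a free variable of `ψ` outside the list `x`. -/
noncomputable def psubstAux {m : ℕ} (j : ℕ) (x : Fin m → ℕ) (ψ : QForm) :
    (ℕ → ℕ) → QForm → QForm
  | σ, atom n k y =>
      if h : n = m ∧ k = j then
        vsubst (Function.extend x (fun i => σ (y (Fin.cast h.1.symm i))) id) ψ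
      else atom n k (σ ∘ y)
  | σ, neg φ => neg (psubstAux j x ψ σ φ)
  | σ, or φ χ => or (psubstAux j x ψ σ φ) (psubstAux j x ψ σ χ)
  | σ, dia φ => dia (psubstAux j x ψ σ φ)
  | σ, ex u φ =>
      let z := avoid (((fv φ).erase u).image σ ∪ (fv ψ \ Finset.univ.image x)) u
      ex z (psubstAux j x ψ (Function.update σ u z) φ)

/-- `φ[ψ/P(x)]` for the `m`-ary predicate `P = P^m_j` and a list `x` of `m` variables: every
occurrence of `P(y)` in `φ` is replaced by `ψ[y/x]`, without capture of free variables. -/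
noncomputable def psubst {m : ℕ} (j : ℕ) (x : Fin m → ℕ) (ψ φ : QForm) : QForm :=
  psubstAux j x ψ id φ

/-- Classical tautologies: true under every assignment of truth values to formulas that
respects `¬` and `∨`. -/
def IsTautology (φ : QForm) : Prop :=
  ∀ v : QForm → Prop, (∀ α, v (neg α) ↔ ¬ v α) → (∀ α β, v (or α β) ↔ (v α ∨ v β)) → v φ

/-- The axioms of the classical predicate calculus. -/
inductive ClassicalAx : Set QForm
  | taut {φ : QForm} : φ.IsTautology → ClassicalAx φ
  | allElim (x y : ℕ) (φ : QForm) :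
      ClassicalAx (imp (all x φ) (vsubst (Function.update id x y) φ))
  | exIntro (x y : ℕ) (φ : QForm) :
      ClassicalAx (imp (vsubst (Function.update id x y) φ) (ex x φ))
  | allDistrib (x : ℕ) (φ ψ : QForm) : x ∉ fv φ →
      ClassicalAx (imp (all x (imp φ ψ)) (imp φ (all x ψ)))
  | exDistrib (x : ℕ) (φ ψ : QForm) : x ∉ fv φ →
      ClassicalAx (imp (all x (imp ψ φ)) (imp (ex x ψ) φ))

/-- Propositional modal formulas as predicate formulas: propositional letters are the `0`-ary
predicates. -/
def ofPForm : PForm → QForm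
  | .letter p => atom 0 p Fin.elim0
  | .neg φ => neg (ofPForm φ)
  | .or φ ψ => or (ofPForm φ) (ofPForm ψ)
  | .dia φ => dia (ofPForm φ)

/-- `□∀x(□(□P(x) → □∀xP(x)) → □∀xP(x)) → □∀xP(x)`, with `P` the first unary predicate and `x`
the first variable. -/
def plusFormula : QForm :=
  let Px : QForm := atom 1 0 (fun _ => 0)
  imp
    (box (all 0 (imp (box (imp (box Px) (box (all 0 Px)))) (box (all 0 Px)))))
    (box (all 0 Px))

end QForm

/-- The least set of predicate modal formulas containing `Γ` and closed under modus ponens,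
necessitation, generalization and uniform substitution of formulas for predicates. -/
inductive QClosure (Γ : Set QForm) : Set QForm
  | base {φ : QForm} : φ ∈ Γ → QClosure Γ φ
  | mp {φ ψ : QForm} : QClosure Γ φ → QClosure Γ (φ.imp ψ) → QClosure Γ ψ
  | nec {φ : QForm} : QClosure Γ φ → QClosure Γ φ.box
  | gen {φ : QForm} (x : ℕ) : QClosure Γ φ → QClosure Γ (φ.all x)
  | subst {φ : QForm} {m : ℕ} (j : ℕ) (x : Fin m → ℕ) (ψ : QForm) :
      Function.Injective x → QClosure Γ φ → QClosure Γ (QForm.psubst j x ψ φ)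

/-- The least predicate extension **QL** of a propositional modal logic **L**. -/
def predicateExt (L : Set PForm) : Set QForm :=
  QClosure (QForm.ClassicalAx ∪ QForm.ofPForm '' L)

/-- **QGL**. -/
def QGL : Set QForm := predicateExt logicGL

/-- **Q⁺Grz** `= QGrz + □∀x(□(□P(x) → □∀xP(x)) → □∀xP(x)) → □∀xP(x)`. -/
def QPlusGrz : Set QForm := QClosure (insert QForm.plusFormula (predicateExt logicGrz))

/-! ## Monadic fragments -/

/-- The translation `φ ↦ φᵗ`, for a fixed variable `x` and an assignment `s` of unary predicates
`p* = P^1_{s p}` to the propositional letters `p`. -/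
def transl (x : ℕ) (s : ℕ → ℕ) : MForm → QForm
  | .letter p => .atom 1 (s p) (fun _ => x)
  | .neg φ => .neg (transl x s φ)
  | .or φ ψ => .or (transl x s φ) (transl x s ψ)
  | .dia φ => .dia (transl x s φ)
  | .ex φ => .ex x (transl x s φ)

/-- `M` is the monadic fragment of `Q` (with respect to the translation given by `x` and `s`). -/
def IsMonadicFragment (x : ℕ) (s : ℕ → ℕ) (M : Set MForm) (Q : Set QForm) : Prop :=
  ∀ φ : MForm, φ ∈ M ↔ transl x s φ ∈ Q

end MonadicModal

/-! That translations of theorems are theorems is shown by induction on derivations in the monadic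
logic. The work here lies in substitution: the translated axioms come from the propositional ones by
substituting for letters one at a time, and bound variables must not be renamed on the way
(`inst_mem`, `transl_subst`). For the additional axiom of the Grzegorczyk case, the bound variable
must also be changed (`transl_plusFormula_mem`).

For the converse, let `φ` be outside the monadic logic and let `S` be the finite set of its
subformulas. Some maximal theory `a` omits `φ`. In the canonical bimodal model an `∃`-class plays
the part of a world and its points that of individuals; each class is replaced by its description,
the finite set of the `S`-types of its points. A countermodel is built from descriptions only:
individuals are types, and an arrow is a function between sets of types compatible with `◇`. Several
individuals may be sent to the same one, which is sound in the absence of equality.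

The frame has to be transitive and conversely well-founded (with identity arrows added for Grz), so
worlds are descriptions with a rank, and ranks decrease along the non-identity arrows. The key claim
is that every description has a rank (`Realizes`). It is proved by induction on the number of
rankless descriptions accessible from the point. For GL, Löb's axiom supplies a last successor with
a given description. For Grz, the additional axiom together with Grzegorczyk's gives a successor
with the same description in which every type has a stable representative (`exists_stable`): a move
of this representative that changes its type loses access to the description. Soundness
(`valid_of_mem_QGL`, `valid_of_mem_QPlusGrz`) and the truth lemma `sat_transl_typeFrame` then show
that the translation of `φ` is not a theorem. -/

namespace MonadicModal

/-! ### Simultaneous substitution in bimodal formulas. -/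

namespace MForm

/-- Simultaneous substitution. -/
def msub (σ : ℕ → MForm) : MForm → MForm
  | letter p => σ p
  | neg φ => neg (msub σ φ)
  | or φ ψ => or (msub σ φ) (msub σ ψ)
  | dia φ => dia (msub σ φ)
  | ex φ => ex (msub σ φ)

/-- All letters of the formula are below `N`. -/
def LettersLT (N : ℕ) : MForm → Prop
  | letter p => p < N
  | neg φ => LettersLT N φ
  | or φ ψ => LettersLT N φ ∧ LettersLT N ψ
  | dia φ => LettersLT N φ
  | ex φ => LettersLT N φ

theorem LettersLT.mono {M N : ℕ} (h : M ≤ N) {φ : MForm} (hφ : LettersLT M φ) :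
    LettersLT N φ := by
  induction φ with
  | letter p => exact lt_of_lt_of_le hφ h
  | or φ ψ ih₁ ih₂ => exact ⟨ih₁ hφ.1, ih₂ hφ.2⟩
  | neg φ ih | dia φ ih | ex φ ih => exact ih hφ

theorem exists_lettersLT : ∀ φ : MForm, ∃ N, LettersLT N φ
  | letter p => ⟨p + 1, Nat.lt_succ_self p⟩
  | neg φ => exists_lettersLT φ
  | or φ ψ =>
    let ⟨M, hM⟩ := exists_lettersLT φ
    let ⟨N, hN⟩ := exists_lettersLT ψ
    ⟨max M N, hM.mono (le_max_left _ _), hN.mono (le_max_right _ _)⟩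
  | dia φ => exists_lettersLT φ
  | ex φ => exists_lettersLT φ

theorem msub_congr {N : ℕ} {σ τ : ℕ → MForm} (h : ∀ j < N, σ j = τ j) {φ : MForm}
    (hφ : LettersLT N φ) : msub σ φ = msub τ φ := by
  induction φ with
  | letter p => exact h p hφ
  | neg φ ih => exact congrArg neg (ih hφ)
  | or φ ψ ih₁ ih₂ => exact congrArg₂ or (ih₁ hφ.1) (ih₂ hφ.2)
  | dia φ ih => exact congrArg dia (ih hφ)
  | ex φ ih => exact congrArg ex (ih hφ)

theorem msub_msub (σ τ : ℕ → MForm) (φ : MForm) :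
    msub σ (msub τ φ) = msub (fun j => msub σ (τ j)) φ := by
  induction φ <;> simp_all [msub]

theorem msub_letter (φ : MForm) : msub letter φ = φ := by
  induction φ <;> simp_all [msub]

theorem subst_eq_msub (p : ℕ) (ψ φ : MForm) :
    subst p ψ φ = msub (Function.update letter p ψ) φ := by
  induction φ with
  | letter q => simp [subst, msub, Function.update_apply]
  | _ => simp_all [subst, msub]

/-- Single substitutions would interfere with one another. So the letters `j < K` of `φ` are first
renamed one by one to `N + j`, which occur neither in `φ` nor in any `σ j`, and the fresh letters
are then replaced one by one. -/
theorem msub_mem {S : Set MForm} (hS : ∀ p ψ φ, φ ∈ S → subst p ψ φ ∈ S) (σ : ℕ → MForm)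
    {φ : MForm} (hφ : φ ∈ S) : msub σ φ ∈ S := by
  obtain ⟨K, hK⟩ := exists_lettersLT φ
  obtain ⟨N, hKN, hN⟩ : ∃ N, K ≤ N ∧ ∀ j < K, LettersLT N (σ j) := by
    choose f hf using fun j => exists_lettersLT (σ j)
    refine ⟨K + ∑ j ∈ Finset.range K, f j, Nat.le_add_right _ _, fun j hj => (hf j).mono ?_⟩
    have := Finset.single_le_sum (f := f) (fun i _ => Nat.zero_le _) (Finset.mem_range.2 hj)
    omega
  have h₁ : ∀ i ≤ K, msub (fun j => if j < i then letter (N + j) else letter j) φ ∈ S := by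
    intro i
    induction i with
    | zero => intro _; simpa [msub_letter] using hφ
    | succ i ih =>
      intro hi
      have h := hS i (letter (N + i)) _ (ih (by omega))
      rw [subst_eq_msub, msub_msub] at h
      convert h using 3 with j
      rcases lt_trichotomy j i with hj | rfl | hj
      · rw [if_pos (by omega), if_pos hj, msub, Function.update_of_ne (by omega)]
      · simp [msub]
      · rw [if_neg (by omega), if_neg (by omega), msub, Function.update_of_ne (by omega)]
  have h₂ : ∀ i ≤ K, msub (fun j => if j < i then σ j else letter (N + j)) φ ∈ S := by
    intro i
    induction i with
    | zero =>
      intro _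
      have h := h₁ K le_rfl
      rw [msub_congr (τ := fun j => letter (N + j)) (fun j hj => by simp [hj]) hK] at h
      simpa using h
    | succ i ih =>
      intro hi
      have h := hS (N + i) (σ i) _ (ih (by omega))
      rw [subst_eq_msub, msub_msub] at h
      convert h using 3 with j
      rcases lt_trichotomy j i with hj | rfl | hj
      · rw [if_pos (by omega), if_pos hj]
        rw [msub_congr (τ := letter) (fun k hk => by
          rw [Function.update_of_ne (by omega)]) (hN j (by omega)), msub_letter]
      · simp [msub]
      · rw [if_neg (by omega), if_neg (by omega), msub, Function.update_of_ne (by omega)]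
  have h := h₂ K le_rfl
  rwa [msub_congr (τ := σ) (fun j hj => by simp [hj]) hK] at h

end MForm

/-! ### Theorems common to all monadic logics. -/

open MForm

/-- Normal bimodal logics with the **S5** axioms for `∃` and the connecting axiom. -/
structure IsMonadicLogic (L : Set MForm) : Prop where
  mp : ∀ {φ ψ : MForm}, φ ∈ L → φ.imp ψ ∈ L → ψ ∈ L
  boxNec : ∀ {φ : MForm}, φ ∈ L → φ.box ∈ L
  allNec : ∀ {φ : MForm}, φ ∈ L → φ.all ∈ L
  subst : ∀ p ψ φ, φ ∈ L → MForm.subst p ψ φ ∈ L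
  base : ofPForm '' logicK ∪ s5Ax ∪ {connecting} ⊆ L

theorem isMonadicLogic_mclosure {G : Set MForm}
    (h : ofPForm '' logicK ∪ s5Ax ∪ {connecting} ⊆ MClosure G) :
    IsMonadicLogic (MClosure G) :=
  ⟨fun h₁ h₂ => .mp h₁ h₂, fun h => .boxNec h, fun h => .allNec h,
    fun p ψ _ h => .subst p ψ h, h⟩

/-- The substitution sending the letters `0, 1, 2, …` to `α, β, γ, γ, …`. -/
def substThree (α β γ : MForm) : ℕ → MForm
  | 0 => α
  | 1 => β
  | _ => γ

namespace IsMonadicLogic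

variable {L : Set MForm}

theorem msub_mem (hL : IsMonadicLogic L) (σ : ℕ → MForm) {φ : MForm} (h : φ ∈ L) :
    msub σ φ ∈ L :=
  MForm.msub_mem hL.subst σ h

theorem taut_mem (hL : IsMonadicLogic L) (σ : ℕ → MForm) {χ : PForm} (h : χ.IsTautology) :
    msub σ (ofPForm χ) ∈ L :=
  hL.msub_mem σ (hL.base (.inl (.inl ⟨χ, .base (.inl h), rfl⟩)))

theorem imp_const (hL : IsMonadicLogic L) (α β : MForm) : imp α (imp β α) ∈ L :=
  hL.taut_mem (substThree α β α) (χ := .imp (.letter 0) (.imp (.letter 1) (.letter 0)))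
    fun v hn ho => by simp only [PForm.imp, hn, ho]; tauto

theorem imp_distrib (hL : IsMonadicLogic L) (α β γ : MForm) :
    imp (imp α (imp β γ)) (imp (imp α β) (imp α γ)) ∈ L :=
  hL.taut_mem (substThree α β γ)
    (χ := .imp (.imp (.letter 0) (.imp (.letter 1) (.letter 2)))
      (.imp (.imp (.letter 0) (.letter 1)) (.imp (.letter 0) (.letter 2))))
    fun v hn ho => by simp only [PForm.imp, hn, ho]; tauto

theorem imp_self (hL : IsMonadicLogic L) (α : MForm) : imp α α ∈ L :=
  hL.taut_mem (substThree α α α) (χ := .imp (.letter 0) (.letter 0))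
    fun v hn ho => by simp only [PForm.imp, hn, ho]; tauto

theorem imp_cases (hL : IsMonadicLogic L) (α γ : MForm) :
    imp (imp α γ) (imp (imp (neg α) γ) γ) ∈ L :=
  hL.taut_mem (substThree α γ γ)
    (χ := .imp (.imp (.letter 0) (.letter 1))
      (.imp (.imp (.neg (.letter 0)) (.letter 1)) (.letter 1)))
    fun v hn ho => by simp only [PForm.imp, hn, ho]; tauto

theorem absurd (hL : IsMonadicLogic L) (α γ : MForm) : imp α (imp (neg α) γ) ∈ L :=
  hL.taut_mem (substThree α γ γ)
    (χ := .imp (.letter 0) (.imp (.neg (.letter 0)) (.letter 1)))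
    fun v hn ho => by simp only [PForm.imp, hn, ho]; tauto

theorem or_left (hL : IsMonadicLogic L) (α β : MForm) : imp α (or α β) ∈ L :=
  hL.taut_mem (substThree α β β)
    (χ := .imp (.letter 0) (.or (.letter 0) (.letter 1)))
    fun v hn ho => by simp only [PForm.imp, hn, ho]; tauto

theorem or_right (hL : IsMonadicLogic L) (α β : MForm) : imp β (or α β) ∈ L :=
  hL.taut_mem (substThree α β β)
    (χ := .imp (.letter 1) (.or (.letter 0) (.letter 1)))
    fun v hn ho => by simp only [PForm.imp, hn, ho]; tauto

theorem or_elim (hL : IsMonadicLogic L) (α β : MForm) : imp (or α β) (imp (neg α) β) ∈ L :=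
  hL.taut_mem (substThree α β β)
    (χ := .imp (.or (.letter 0) (.letter 1)) (.imp (.neg (.letter 0)) (.letter 1)))
    fun v hn ho => by simp only [PForm.imp, hn, ho]; tauto

theorem and_left (hL : IsMonadicLogic L) (α β : MForm) : imp (and α β) α ∈ L :=
  hL.taut_mem (substThree α β β)
    (χ := .imp (.and (.letter 0) (.letter 1)) (.letter 0))
    fun v hn ho => by simp only [PForm.imp, PForm.and, hn, ho]; tauto

theorem and_right (hL : IsMonadicLogic L) (α β : MForm) : imp (and α β) β ∈ L :=
  hL.taut_mem (substThree α β β)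
    (χ := .imp (.and (.letter 0) (.letter 1)) (.letter 1))
    fun v hn ho => by simp only [PForm.imp, PForm.and, hn, ho]; tauto

theorem box_distrib (hL : IsMonadicLogic L) (α β : MForm) :
    imp (box (imp α β)) (imp (box α) (box β)) ∈ L :=
  hL.msub_mem (substThree α β β)
    (hL.base (.inl (.inl ⟨_, .base (.inr (.inl rfl)), rfl⟩)))

theorem dia_duality (hL : IsMonadicLogic L) (α : MForm) :
    iff (dia α) (neg (box (neg α))) ∈ L :=
  hL.msub_mem (substThree α α α)
    (hL.base (.inl (.inl ⟨_, .base (.inr (.inr rfl)), rfl⟩)))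

theorem s5_mem (hL : IsMonadicLogic L) (σ : ℕ → MForm) {φ : MForm} (h : φ ∈ s5Ax) :
    msub σ φ ∈ L :=
  hL.msub_mem σ (hL.base (.inl (.inr h)))

theorem all_distrib (hL : IsMonadicLogic L) (α β : MForm) :
    imp (all (imp α β)) (imp (all α) (all β)) ∈ L :=
  hL.s5_mem (substThree α β β) (.inl rfl)

theorem ex_duality (hL : IsMonadicLogic L) (α : MForm) :
    iff (ex α) (neg (all (neg α))) ∈ L :=
  hL.s5_mem (substThree α α α) (.inr (.inl rfl))

theorem ex_refl (hL : IsMonadicLogic L) (α : MForm) : imp α (ex α) ∈ L :=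
  hL.s5_mem (substThree α α α) (.inr (.inr (.inl rfl)))

theorem ex_all_ex (hL : IsMonadicLogic L) (α : MForm) : imp (ex α) (all (ex α)) ∈ L :=
  hL.s5_mem (substThree α α α) (.inr (.inr (.inr (.inr rfl))))

theorem connecting_mem (hL : IsMonadicLogic L) (α : MForm) :
    imp (ex (dia α)) (dia (ex α)) ∈ L :=
  hL.msub_mem (substThree α α α) (hL.base (.inr rfl))

end IsMonadicLogic

/-! ### Maximal theories and the canonical bimodal model. -/

/-- Derivability from a set of hypotheses by the theorems of `L` and modus ponens. -/
inductive Derives (L G : Set MForm) : MForm → Prop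
  | hyp {φ : MForm} : φ ∈ G → Derives L G φ
  | ax {φ : MForm} : φ ∈ L → Derives L G φ
  | mp {φ ψ : MForm} : Derives L G φ → Derives L G (φ.imp ψ) → Derives L G ψ

namespace Derives

variable {L G H : Set MForm} {φ ψ : MForm}

theorem mono (h : G ⊆ H) (d : Derives L G φ) : Derives L H φ := by
  induction d with
  | hyp h' => exact .hyp (h h')
  | ax h' => exact .ax h'
  | mp _ _ ih₁ ih₂ => exact .mp ih₁ ih₂

/-- `Derives` has no necessitation rules, so the usual induction goes through. -/
theorem deduction (hL : IsMonadicLogic L) (d : Derives L (insert φ G) ψ) :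
    Derives L G (φ.imp ψ) := by
  induction d with
  | @hyp χ h' =>
    rcases h' with rfl | h'
    · exact .ax (hL.imp_self _)
    · exact .mp (.hyp h') (.ax (hL.imp_const _ _))
  | ax h' => exact .mp (.ax h') (.ax (hL.imp_const _ _))
  | mp _ _ ih₁ ih₂ => exact .mp ih₁ (.mp ih₂ (.ax (hL.imp_distrib _ _ _)))

theorem exists_of_sUnion {c : Set (Set MForm)} (hc : IsChain (· ⊆ ·) c) (hne : c.Nonempty)
    (d : Derives L (⋃₀ c) φ) : ∃ G ∈ c, Derives L G φ := by
  induction d with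
  | hyp h' => obtain ⟨G, hG, h⟩ := h'; exact ⟨G, hG, .hyp h⟩
  | ax h' => obtain ⟨G, hG⟩ := hne; exact ⟨G, hG, .ax h'⟩
  | mp _ _ ih₁ ih₂ =>
    obtain ⟨G, hG, d₁⟩ := ih₁
    obtain ⟨H, hH, d₂⟩ := ih₂
    rcases hc.total hG hH with h | h
    · exact ⟨H, hH, .mp (d₁.mono h) d₂⟩
    · exact ⟨G, hG, .mp d₁ (d₂.mono h)⟩

/-- Hypotheses from a set `H` directed under conjunction are reduced to a single one. -/
theorem exists_imp_of_union (hL : IsMonadicLogic L) (hne : H.Nonempty)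
    (hH : ∀ α ∈ H, ∀ β ∈ H, ∃ γ ∈ H, imp γ α ∈ L ∧ imp γ β ∈ L)
    (d : Derives L (G ∪ H) φ) : ∃ γ ∈ H, Derives L G (γ.imp φ) := by
  induction d with
  | @hyp χ h' =>
    rcases h' with h' | h'
    · obtain ⟨γ, hγ⟩ := hne
      exact ⟨γ, hγ, .mp (.hyp h') (.ax (hL.imp_const _ _))⟩
    · exact ⟨χ, h', .ax (hL.imp_self _)⟩
  | ax h' =>
    obtain ⟨γ, hγ⟩ := hne
    exact ⟨γ, hγ, .mp (.ax h') (.ax (hL.imp_const _ _))⟩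
  | mp _ _ ih₁ ih₂ =>
    obtain ⟨α, hα, d₁⟩ := ih₁
    obtain ⟨β, hβ, d₂⟩ := ih₂
    obtain ⟨γ, hγ, h₁, h₂⟩ := hH α hα β hβ
    have key : ∀ {δ ε : MForm}, imp γ δ ∈ L → Derives L G (δ.imp ε) →
        Derives L G (γ.imp ε) := fun h d =>
      .mp (.ax h) (.mp (.mp d (.ax (hL.imp_const _ _))) (.ax (hL.imp_distrib _ _ _)))
    exact ⟨γ, hγ, .mp (key h₁ d₁) (.mp (key h₂ d₂) (.ax (hL.imp_distrib _ _ _)))⟩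

end Derives

/-- Maximal consistent theories of `L`. -/
structure MaxTheory (L : Set MForm) where
  carrier : Set MForm
  ax : L ⊆ carrier
  mp : ∀ {φ ψ : MForm}, φ ∈ carrier → φ.imp ψ ∈ carrier → ψ ∈ carrier
  neg_mem_iff : ∀ {φ : MForm}, neg φ ∈ carrier ↔ φ ∉ carrier

variable {L : Set MForm}

/-- Lindenbaum's lemma. -/
theorem exists_maxTheory (hL : IsMonadicLogic L) {G : Set MForm} {φ : MForm}
    (h : ¬ Derives L G φ) : ∃ a : MaxTheory L, G ⊆ a.carrier ∧ φ ∉ a.carrier := by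
  obtain ⟨A, hGA, hA⟩ := zorn_subset_nonempty {A | ¬ Derives L A φ}
    (fun c hc hch hne => ⟨⋃₀ c, fun d => by
      obtain ⟨A, hA, d'⟩ := d.exists_of_sUnion hch hne
      exact hc hA d', fun s hs => Set.subset_sUnion_of_mem hs⟩) G h
  have closed : ∀ {ψ}, Derives L A ψ → ψ ∈ A := by
    intro ψ d
    by_contra hψ
    have hd : Derives L (insert ψ A) φ := by
      by_contra hn
      exact hψ (hA.2 hn (Set.subset_insert _ _) (Set.mem_insert _ _))
    exact hA.1 (.mp d (hd.deduction hL))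
  refine ⟨⟨A, fun ψ hψ => closed (.ax hψ), fun h₁ h₂ => closed (.mp (.hyp h₁) (.hyp h₂)), ?_⟩,
    hGA, fun h => hA.1 (.hyp h)⟩
  intro ψ
  constructor
  · intro hn hp
    exact hA.1 (.mp (.hyp hn) (.mp (.hyp hp) (.ax (hL.absurd _ _))))
  -- If neither `ψ` nor its negation lay in `A`, maximality would make `φ` derivable from each of
  -- them, hence from `A` by cases.
  · intro hp
    by_contra hn
    have key : ∀ {χ}, χ ∉ A → Derives L A (imp χ φ) := fun {χ} hχ => by
      refine Derives.deduction hL ?_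
      by_contra hd
      exact hχ (hA.2 hd (Set.subset_insert _ _) (Set.mem_insert _ _))
    exact hA.1 (.mp (key hn) (.mp (key hp) (.ax (hL.imp_cases _ _))))

namespace MaxTheory

instance : Membership MForm (MaxTheory L) := ⟨fun a φ => φ ∈ a.carrier⟩

variable {a b c : MaxTheory L} {φ ψ : MForm}

theorem mem_neg : neg φ ∈ a ↔ φ ∉ a := a.neg_mem_iff

theorem mem_of_imp (h : imp φ ψ ∈ L) (hφ : φ ∈ a) : ψ ∈ a := a.mp hφ (a.ax h)

theorem mem_or (hL : IsMonadicLogic L) : or φ ψ ∈ a ↔ φ ∈ a ∨ ψ ∈ a := by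
  constructor
  · intro h
    by_contra! hn
    exact hn.2 (a.mp (mem_neg.2 hn.1) (mem_of_imp (hL.or_elim _ _) h))
  · rintro (h | h)
    · exact mem_of_imp (hL.or_left _ _) h
    · exact mem_of_imp (hL.or_right _ _) h

theorem mem_imp (hL : IsMonadicLogic L) : imp φ ψ ∈ a ↔ (φ ∈ a → ψ ∈ a) := by
  rw [imp, mem_or hL, mem_neg]; tauto

theorem mem_and (hL : IsMonadicLogic L) : and φ ψ ∈ a ↔ φ ∈ a ∧ ψ ∈ a := by
  rw [MForm.and, mem_neg, mem_or hL, mem_neg, mem_neg]; tauto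

theorem mem_iff_of_iff (hL : IsMonadicLogic L) (h : iff φ ψ ∈ L) : φ ∈ a ↔ ψ ∈ a := by
  have := (mem_and hL).1 (a.ax h)
  rw [mem_imp hL, mem_imp hL] at this
  exact ⟨this.1, this.2⟩

/-- The accessibility relation of `□`. -/
def R (a b : MaxTheory L) : Prop := ∀ φ : MForm, box φ ∈ a → φ ∈ b

/-- The accessibility relation of `∀`. -/
def E (a b : MaxTheory L) : Prop := ∀ φ : MForm, all φ ∈ a → φ ∈ b

theorem derives_box (hL : IsMonadicLogic L) (d : Derives L {α | box α ∈ a} φ) : box φ ∈ a := by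
  induction d with
  | hyp h => exact h
  | ax h => exact a.ax (hL.boxNec h)
  | mp _ _ ih₁ ih₂ => exact a.mp ih₁ (mem_of_imp (hL.box_distrib _ _) ih₂)

theorem derives_all (hL : IsMonadicLogic L) (d : Derives L {α | all α ∈ a} φ) : all φ ∈ a := by
  induction d with
  | hyp h => exact h
  | ax h => exact a.ax (hL.allNec h)
  | mp _ _ ih₁ ih₂ => exact a.mp ih₁ (mem_of_imp (hL.all_distrib _ _) ih₂)

theorem mem_box (hL : IsMonadicLogic L) : box φ ∈ a ↔ ∀ b, R a b → φ ∈ b := by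
  refine ⟨fun h b hb => hb _ h, fun h => ?_⟩
  by_contra hn
  obtain ⟨b, hb, hφ⟩ := exists_maxTheory hL fun d => hn (derives_box hL d)
  exact hφ (h b fun ψ hψ => hb hψ)

theorem mem_all (hL : IsMonadicLogic L) : all φ ∈ a ↔ ∀ b, E a b → φ ∈ b := by
  refine ⟨fun h b hb => hb _ h, fun h => ?_⟩
  by_contra hn
  obtain ⟨b, hb, hφ⟩ := exists_maxTheory hL fun d => hn (derives_all hL d)
  exact hφ (h b fun ψ hψ => hb hψ)

theorem mem_dia (hL : IsMonadicLogic L) : dia φ ∈ a ↔ ∃ b, R a b ∧ φ ∈ b := by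
  rw [mem_iff_of_iff hL (hL.dia_duality φ), mem_neg, mem_box hL]
  simp only [mem_neg]; push Not; rfl

theorem mem_ex (hL : IsMonadicLogic L) : ex φ ∈ a ↔ ∃ b, E a b ∧ φ ∈ b := by
  rw [mem_iff_of_iff hL (hL.ex_duality φ), mem_neg, mem_all hL]
  simp only [mem_neg]; push Not; rfl

theorem E_refl (hL : IsMonadicLogic L) (a : MaxTheory L) : E a a := by
  intro φ h
  by_contra hn
  obtain ⟨b, hb, h'⟩ := (mem_ex hL).1 (mem_of_imp (hL.ex_refl _) (mem_neg.2 hn))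
  exact mem_neg.1 h' (hb _ h)

theorem E_euclid (hL : IsMonadicLogic L) (h : E a b) (h' : E a c) : E b c := by
  intro φ hb
  by_contra hn
  have h₁ : ex (neg φ) ∈ a := (mem_ex hL).2 ⟨c, h', mem_neg.2 hn⟩
  exact mem_neg.1 hb (h _ (mem_of_imp (hL.ex_all_ex _) h₁))

theorem E_symm (hL : IsMonadicLogic L) (h : E a b) : E b a := E_euclid hL h (E_refl hL a)

theorem E_trans (hL : IsMonadicLogic L) (h : E a b) (h' : E b c) : E a c :=
  E_euclid hL (E_symm hL h) h'

/-- This is the canonical content of the connecting axiom. It lets all points of an `E`-class move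
together into the class of `c`. The point `d` contains what is boxed in `a` and the formulas `∀γ` of
`c`. -/
theorem exists_R_of_E (hL : IsMonadicLogic L) (h : E a b) (h' : R b c) :
    ∃ d, R a d ∧ E d c := by
  -- The negation of `T` serves as falsum.
  set T : MForm := imp (letter 0) (letter 0)
  have hT : ∀ d : MaxTheory L, T ∈ d := fun d => d.ax (hL.imp_self _)
  have hd : ¬ Derives L ({α | box α ∈ a} ∪ {β | β ∈ c ∧ β ∈ Set.range all}) (neg T) := by
    intro d
    obtain ⟨-, ⟨hγ, γ, rfl⟩, d⟩ := d.exists_imp_of_union hL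
      (⟨all T, (mem_all hL).2 fun d _ => hT d, ⟨T, rfl⟩⟩ : {β | β ∈ c ∧ β ∈ Set.range all}.Nonempty) (by
        rintro _ ⟨hα, α, rfl⟩ _ ⟨hβ, β, rfl⟩
        refine ⟨all (MForm.and α β), ⟨(mem_all hL).2 fun d hd => (mem_and hL).2
          ⟨(mem_all hL).1 hα d hd, (mem_all hL).1 hβ d hd⟩,
          _, rfl⟩, ?_, ?_⟩
        · exact hL.mp (hL.allNec (hL.and_left α β)) (hL.all_distrib _ _)
        · exact hL.mp (hL.allNec (hL.and_right α β)) (hL.all_distrib _ _))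
    have h₁ : ex (dia (all γ)) ∈ a := (mem_ex hL).2 ⟨b, h, (mem_dia hL).2 ⟨c, h', hγ⟩⟩
    obtain ⟨e, he, h₂⟩ := (mem_dia hL).1 (mem_of_imp (hL.connecting_mem _) h₁)
    obtain ⟨f, hf, h₃⟩ := (mem_ex hL).1 h₂
    -- The connecting axiom only yields `∃∀γ` at `e`; **S5** reduces it to `∀γ`.
    have h₄ : all γ ∈ e := (mem_all hL).2 fun g hg =>
      (mem_all hL).1 h₃ g (E_euclid hL hf hg)
    exact mem_neg.1 ((mem_imp hL).1 (he _ (derives_box hL d)) h₄) (hT e)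
  obtain ⟨d, hd, -⟩ := exists_maxTheory hL hd
  refine ⟨d, fun φ hφ => hd (.inl hφ), E_symm hL fun φ hφ => ?_⟩
  exact E_refl hL d φ (hd (.inr ⟨hφ, φ, rfl⟩))

end MaxTheory
end MonadicModal

/-! ### Types, descriptions and their realization with finite rank. -/

namespace MonadicModal
open MForm

/-- Sets of formulas closed under immediate subformulas. -/
structure SubformulaClosed (S : Set MForm) : Prop where
  neg : ∀ {φ : MForm}, neg φ ∈ S → φ ∈ S
  or : ∀ {φ ψ : MForm}, or φ ψ ∈ S → φ ∈ S ∧ ψ ∈ S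
  dia : ∀ {φ : MForm}, dia φ ∈ S → φ ∈ S
  ex : ∀ {φ : MForm}, ex φ ∈ S → φ ∈ S

/-- The subformulas of a formula. -/
def MForm.subformulas : MForm → Set MForm
  | letter p => {letter p}
  | neg φ => insert (neg φ) (subformulas φ)
  | or φ ψ => insert (or φ ψ) (subformulas φ ∪ subformulas ψ)
  | dia φ => insert (dia φ) (subformulas φ)
  | ex φ => insert (ex φ) (subformulas φ)

theorem MForm.finite_subformulas (φ : MForm) : φ.subformulas.Finite := by
  induction φ <;> simp_all [subformulas]

theorem MForm.mem_subformulas_self (φ : MForm) : φ ∈ φ.subformulas := by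
  cases φ <;> simp [subformulas]

theorem MForm.subformulaClosed_subformulas (φ : MForm) : SubformulaClosed φ.subformulas := by
  induction φ with
  | letter p => constructor <;> simp [subformulas]
  | or φ ψ ih₁ ih₂ =>
    constructor
    · rintro χ (h | h | h)
      · cases h
      · exact .inr (.inl (ih₁.neg h))
      · exact .inr (.inr (ih₂.neg h))
    · rintro χ₁ χ₂ (h | h | h)
      · cases h
        exact ⟨.inr (.inl (mem_subformulas_self _)), .inr (.inr (mem_subformulas_self _))⟩
      · exact ⟨.inr (.inl (ih₁.or h).1), .inr (.inl (ih₁.or h).2)⟩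
      · exact ⟨.inr (.inr (ih₂.or h).1), .inr (.inr (ih₂.or h).2)⟩
    · rintro χ (h | h | h)
      · cases h
      · exact .inr (.inl (ih₁.dia h))
      · exact .inr (.inr (ih₂.dia h))
    · rintro χ (h | h | h)
      · cases h
      · exact .inr (.inl (ih₁.ex h))
      · exact .inr (.inr (ih₂.ex h))
  | neg φ ih | dia φ ih | ex φ ih =>
    constructor
    · rintro χ (h | h)
      · cases h <;> exact .inr (mem_subformulas_self _)
      · exact .inr (ih.neg h)
    · rintro χ₁ χ₂ (h | h)
      · cases h
      · exact ⟨.inr (ih.or h).1, .inr (ih.or h).2⟩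
    · rintro χ (h | h)
      · cases h <;> exact .inr (mem_subformulas_self _)
      · exact .inr (ih.dia h)
    · rintro χ (h | h)
      · cases h <;> exact .inr (mem_subformulas_self _)
      · exact .inr (ih.ex h)

/-- A set `T` of types over `S` is locally coherent; the types are reflexive if `r` holds. -/
structure Coherent (r : Prop) (S : Set MForm) (T : Set (Set MForm)) : Prop where
  neg : ∀ t ∈ T, ∀ {φ : MForm}, neg φ ∈ S → (neg φ ∈ t ↔ φ ∉ t)
  or : ∀ t ∈ T, ∀ {φ ψ : MForm}, or φ ψ ∈ S → (or φ ψ ∈ t ↔ φ ∈ t ∨ ψ ∈ t)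
  ex : ∀ t ∈ T, ∀ {φ : MForm}, ex φ ∈ S → (ex φ ∈ t ↔ ∃ u ∈ T, φ ∈ u)
  dia : r → ∀ t ∈ T, ∀ {φ : MForm}, dia φ ∈ S → φ ∈ t → dia φ ∈ t

/-- The type `u` may be the type of an individual in a later world than `t`. -/
def Compat (S t u : Set MForm) : Prop :=
  ∀ φ : MForm, dia φ ∈ S → φ ∈ u ∨ dia φ ∈ u → dia φ ∈ t

/-- The set `T` of types is that of the individuals of a world of rank less than `n`. -/
def Realizes (r : Prop) (S : Set MForm) : ℕ → Set (Set MForm) → Prop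
  | 0, _ => False
  | n + 1, T => Coherent r S T ∧ ∀ t : T, ∀ φ : MForm, dia φ ∈ S → dia φ ∈ t.1 →
      (r ∧ φ ∈ t.1) ∨ ∃ U : Set (Set MForm), Realizes r S n U ∧
        ∃ f : T → U, (∀ u, Compat S u.1 (f u).1) ∧ φ ∈ (f t).1

theorem Realizes.succ {r : Prop} {S : Set MForm} {n : ℕ} {T : Set (Set MForm)}
    (h : Realizes r S n T) : Realizes r S (n + 1) T := by
  induction n generalizing T with
  | zero => exact h.elim
  | succ n ih =>
    refine ⟨h.1, fun t φ h₁ h₂ => (h.2 t φ h₁ h₂).imp_right ?_⟩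
    rintro ⟨U, hU, f⟩
    exact ⟨U, ih hU, f⟩

theorem Realizes.mono {r : Prop} {S : Set MForm} {m n : ℕ} {T : Set (Set MForm)}
    (hmn : m ≤ n) (h : Realizes r S m T) : Realizes r S n T := by
  induction hmn with
  | refl => exact h
  | step _ ih => exact ih.succ

namespace MaxTheory

variable {L : Set MForm} {S : Set MForm} {r : Prop} {a b c : MaxTheory L} {φ ψ : MForm}

/-- The formulas in `S` true at `a`. -/
def type (S : Set MForm) (a : MaxTheory L) : Set MForm := {φ | φ ∈ S ∧ φ ∈ a}

/-- The types of the points of the `E`-class of `a`. -/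
def desc (S : Set MForm) (a : MaxTheory L) : Set (Set MForm) := {t | ∃ b, E a b ∧ type S b = t}

theorem mem_type (h : φ ∈ S) : φ ∈ type S a ↔ φ ∈ a := by simp [type, h]

theorem desc_eq_of_E (hL : IsMonadicLogic L) (h : E a b) : desc S a = desc S b := by
  ext t
  exact ⟨fun ⟨c, h₁, h₂⟩ => ⟨c, E_euclid hL h h₁, h₂⟩, fun ⟨c, h₁, h₂⟩ => ⟨c, E_trans hL h h₁, h₂⟩⟩

theorem desc_subset : desc S a ⊆ 𝒫 S := by
  rintro _ ⟨b, -, rfl⟩ φ h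
  exact h.1

theorem type_mem_desc (hL : IsMonadicLogic L) : type S a ∈ desc S a := ⟨a, E_refl hL a, rfl⟩

theorem coherent_desc (hL : IsMonadicLogic L) (hS : SubformulaClosed S)
    (hr : r → ∀ a : MaxTheory L, R a a) : Coherent r S (desc S a) := by
  constructor
  · rintro _ ⟨b, -, rfl⟩ φ h
    rw [mem_type h, mem_type (hS.neg h), mem_neg]
  · rintro _ ⟨b, -, rfl⟩ φ ψ h
    rw [mem_type h, mem_type (hS.or h).1, mem_type (hS.or h).2, mem_or hL]
  · rintro _ ⟨b, hb, rfl⟩ φ h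
    rw [mem_type h, mem_ex hL]
    constructor
    · rintro ⟨c, hc, h'⟩
      exact ⟨_, ⟨c, E_trans hL hb hc, rfl⟩, (mem_type (hS.ex h)).2 h'⟩
    · rintro ⟨_, ⟨c, hc, rfl⟩, h'⟩
      exact ⟨c, E_euclid hL hb hc, (mem_type (hS.ex h)).1 h'⟩
  · rintro h _ ⟨b, hb, rfl⟩ φ h' h''
    exact (mem_type h').2 ((mem_dia hL).2 ⟨b, hr h b, h''.2⟩)

theorem compat_type (hL : IsMonadicLogic L)
    (htr : ∀ a b c : MaxTheory L, R a b → R b c → R a c) (h : R a b) :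
    Compat S (type S a) (type S b) := by
  rintro φ hφ (h' | h')
  · exact (mem_type hφ).2 ((mem_dia hL).2 ⟨b, h, h'.2⟩)
  · obtain ⟨c, hc, h''⟩ := (mem_dia hL).1 h'.2
    exact (mem_type hφ).2 ((mem_dia hL).2 ⟨c, htr _ _ _ h hc, h''⟩)

/-- One representative per type suffices, because individuals of the countermodel are types. This
freedom of choice is what the Grzegorczyk case needs, where only stable representatives have good
successors. -/
theorem realizes_desc_of_successors (hL : IsMonadicLogic L) (hfin : S.Finite)
    (hS : SubformulaClosed S) (hr : r → ∀ a : MaxTheory L, R a a)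
    (htr : ∀ a b c : MaxTheory L, R a b → R b c → R a c)
    (h : ∀ t ∈ desc S a, ∃ b, E a b ∧ type S b = t ∧ ∀ φ, dia φ ∈ S → dia φ ∈ b →
      (r ∧ φ ∈ b) ∨ ∃ c, R b c ∧ φ ∈ c ∧ ∃ n, Realizes r S n (desc S c)) :
    ∃ n, Realizes r S n (desc S a) := by
  have : Nonempty (MaxTheory L) := ⟨a⟩
  choose! β hE hβ hstep using h
  have key : ∀ t ∈ desc S a, ∀ φ ∈ S, ∀ᶠ n in Filter.atTop, dia φ ∈ S → dia φ ∈ t →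
      (r ∧ φ ∈ t) ∨ ∃ c, R (β t) c ∧ φ ∈ c ∧ Realizes r S n (desc S c) := by
    intro t ht φ _
    by_cases hφ : dia φ ∈ S ∧ dia φ ∈ t
    · rw [← hβ t ht] at hφ
      rcases hstep t ht φ hφ.1 hφ.2.2 with ⟨h₁, h₂⟩ | ⟨c, hc, hφc, n, hn⟩
      · refine Filter.Eventually.of_forall fun n _ _ => .inl ⟨h₁, ?_⟩
        rw [← hβ t ht]
        exact ⟨hS.dia hφ.1, h₂⟩
      · filter_upwards [Filter.eventually_ge_atTop n] with m hm _ _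
        exact .inr ⟨c, hc, hφc, hn.mono hm⟩
    · exact Filter.Eventually.of_forall fun n h₁ h₂ => (hφ ⟨h₁, h₂⟩).elim
  -- There are finitely many types and formulas, and realizability is monotone in the rank, so one
  -- rank `n` serves all witnesses.
  have hdfin : (desc S a).Finite := hfin.finite_subsets.subset desc_subset
  obtain ⟨n, hn⟩ := ((hdfin.eventually_all).2 fun t ht =>
    (hfin.eventually_all).2 (key t ht)).exists
  refine ⟨n + 1, coherent_desc hL hS hr, ?_⟩
  rintro ⟨t, ht⟩ φ h₁ h₂
  refine (hn t ht φ (hS.dia h₁) h₁ h₂).imp_right ?_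
  rintro ⟨c, hc, hφc, hreal⟩
  -- The other representatives follow `t` into the class of `c` by the connecting axiom; `t` itself
  -- must go to `c`, where `φ` holds.
  have hex : ∀ u : desc S a, ∃ d, R (β u.1) d ∧ E d c ∧ (u.1 = t → d = c) := by
    rintro ⟨u, hu⟩
    by_cases hut : u = t
    · subst hut
      exact ⟨c, hc, E_refl hL c, fun _ => rfl⟩
    · obtain ⟨d, h₁, h₂⟩ := exists_R_of_E hL (E_euclid hL (hE u hu) (hE t ht)) hc
      exact ⟨d, h₁, h₂, fun h => (hut h).elim⟩
  choose δ hδ hδc hδt using hex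
  refine ⟨_, hreal, fun u => ⟨type S (δ u), δ u, E_symm hL (hδc u), rfl⟩, fun u => ?_, ?_⟩
  · have := compat_type (S := S) hL htr (hδ u)
    rwa [hβ u.1 u.2] at this
  · exact ⟨hS.dia h₁, by rw [hδt _ rfl]; exact hφc⟩

theorem exists_characteristic (hL : IsMonadicLogic L) {ι : Type*} {I : Set ι} (hI : I.Finite)
    (f : ι → MForm) (P : ι → Prop) :
    ∃ θ : MForm, ∀ a : MaxTheory L, θ ∈ a ↔ ∀ i ∈ I, (f i ∈ a ↔ P i) := by
  induction I, hI using Set.Finite.induction_on with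
  | empty => exact ⟨imp (letter 0) (letter 0), fun a => by simp [mem_imp hL]⟩
  | @insert i I _ _ ih =>
    obtain ⟨θ, hθ⟩ := ih
    by_cases h : P i
    · exact ⟨MForm.and (f i) θ, fun a => by simp [mem_and hL, hθ, h]⟩
    · exact ⟨MForm.and (neg (f i)) θ, fun a => by simp [mem_and hL, mem_neg, hθ, h]⟩

theorem exists_char_type (hL : IsMonadicLogic L) (hfin : S.Finite) {t : Set MForm} (ht : t ⊆ S) :
    ∃ θ : MForm, ∀ a : MaxTheory L, θ ∈ a ↔ type S a = t := by
  obtain ⟨θ, hθ⟩ := exists_characteristic hL hfin id (· ∈ t)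
  refine ⟨θ, fun a => (hθ a).trans ⟨fun h => ?_, ?_⟩⟩
  · ext φ
    exact ⟨fun h' => (h φ h'.1).1 h'.2, fun h' => ⟨ht h', (h φ (ht h')).2 h'⟩⟩
  · rintro rfl φ hφ
    exact (mem_type hφ).symm

/-- A description is fixed by which types occur in the class, that is, by the truth values of `∃θ`
for the characteristic formulas `θ` of the finitely many types. -/
theorem exists_char_desc (hL : IsMonadicLogic L) (hfin : S.Finite) {T : Set (Set MForm)}
    (hT : T ⊆ 𝒫 S) : ∃ χ : MForm, ∀ a : MaxTheory L, χ ∈ a ↔ desc S a = T := by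
  have := fun t : 𝒫 S => exists_char_type hL hfin (S := S) t.2
  choose θ hθ using this
  have : Finite (𝒫 S) := hfin.finite_subsets
  obtain ⟨χ, hχ⟩ := exists_characteristic hL (Set.finite_univ (α := 𝒫 S)) (fun t => ex (θ t))
    (fun t => t.1 ∈ T)
  refine ⟨χ, fun a => (hχ a).trans ?_⟩
  have hex : ∀ t : 𝒫 S, ex (θ t) ∈ a ↔ t.1 ∈ desc S a := fun t => by
    simp only [mem_ex hL, hθ]; rfl
  simp only [hex, Set.mem_univ, true_imp_iff]
  refine ⟨fun h => ?_, fun h t => by rw [h]⟩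
  ext t
  exact ⟨fun h' => (h ⟨t, desc_subset h'⟩).1 h', fun h' => (h ⟨t, hT h'⟩).2 h'⟩

/-- The unrealizable descriptions of the successors of `a`. -/
def defects (r : Prop) (S : Set MForm) (a : MaxTheory L) : Set (Set (Set MForm)) :=
  {T | ∃ b, R a b ∧ desc S b = T ∧ ¬ ∃ n, Realizes r S n T}

theorem finite_defects (hfin : S.Finite) : (defects r S a).Finite :=
  hfin.finite_subsets.finite_subsets.subset (by
    rintro _ ⟨b, -, rfl, -⟩
    exact desc_subset)

theorem defects_subset (htr : ∀ a b c : MaxTheory L, R a b → R b c → R a c) (h : R a b) :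
    defects r S b ⊆ defects r S a :=
  fun _ ⟨c, h₁, h₂⟩ => ⟨c, htr _ _ _ h h₁, h₂⟩

theorem defects_subset_of_E (hL : IsMonadicLogic L) (h : E a b) :
    defects r S b ⊆ defects r S a := by
  rintro T ⟨c, h₁, h₂, h₃⟩
  obtain ⟨d, hd, hdc⟩ := exists_R_of_E hL h h₁
  exact ⟨d, hd, (desc_eq_of_E hL hdc).trans h₂, h₃⟩

/-! ### Löb's axiom -/

/-- The contrapositive of Löb's axiom for the negation of `φ`. -/
theorem exists_R_last (hL : IsMonadicLogic L)
    (hloeb : ∀ φ, imp (box (imp (box φ) φ)) (box φ) ∈ L) (h : R a b) (hφ : φ ∈ b) :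
    ∃ c, R a c ∧ φ ∈ c ∧ ∀ d, R c d → φ ∉ d := by
  have h₁ : box (neg φ) ∉ a := fun h' => mem_neg.1 ((mem_box hL).1 h' b h) hφ
  have h₂ : box (imp (box (neg φ)) (neg φ)) ∉ a := fun h' => h₁ (mem_of_imp (hloeb _) h')
  rw [mem_box hL] at h₂
  push Not at h₂
  obtain ⟨c, hc, h₃⟩ := h₂
  rw [mem_imp hL, mem_neg] at h₃
  push Not at h₃
  exact ⟨c, hc, h₃.2, fun d hd => mem_neg.1 ((mem_box hL).1 h₃.1 d hd)⟩

/-- The standard derivation of transitivity: Löb's axiom is applied to `φ ∧ □φ`. -/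
theorem R_trans_of_loeb (hL : IsMonadicLogic L)
    (hloeb : ∀ φ, imp (box (imp (box φ) φ)) (box φ) ∈ L) (h : R a b) (h' : R b c) : R a c := by
  intro φ hφ
  have h₁ : box (MForm.and φ (box φ)) ∈ a := by
    refine mem_of_imp (hloeb _) ((mem_box hL).2 fun d hd => (mem_imp hL).2 fun hd' => ?_)
    refine (mem_and hL).2 ⟨hd _ hφ, (mem_box hL).2 fun e he => ?_⟩
    exact ((mem_and hL).1 ((mem_box hL).1 hd' e he)).1
  exact (mem_box hL).1 ((mem_and hL).1 (h _ h₁)).2 c h'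

/-- Induction on the number of defects. If a successor of `a` had an unrealizable description, a
last successor with this description would no longer see it. It would have fewer defects than `a`,
and so a realizable description after all. Hence all successors of `a` are realizable, and so is
`a`. -/
theorem realizes_desc_of_loeb (hL : IsMonadicLogic L)
    (hloeb : ∀ φ, imp (box (imp (box φ) φ)) (box φ) ∈ L) (hfin : S.Finite)
    (hS : SubformulaClosed S) (a : MaxTheory L) : ∃ n, Realizes False S n (desc S a) := by
  induction hk : (defects False S a).ncard using Nat.strong_induction_on generalizing a with
  | _ k ih =>
    subst hk
    have htr : ∀ a b c : MaxTheory L, R a b → R b c → R a c :=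
      fun _ _ _ => R_trans_of_loeb hL hloeb
    have hreal : ∀ b, R a b → ∃ n, Realizes False S n (desc S b) := by
      intro b hb
      by_contra hn
      obtain ⟨χ, hχ⟩ := exists_char_desc (L := L) hL hfin (desc_subset (S := S) (a := b))
      obtain ⟨c, hc, hχc, hlast⟩ := exists_R_last hL hloeb hb ((hχ b).2 rfl)
      refine hn ?_
      rw [← (hχ c).1 hχc]
      refine ih _ (Set.ncard_lt_ncard ⟨defects_subset htr hc, fun hsub => ?_⟩
        (finite_defects hfin)) c rfl
      obtain ⟨d, hd, hd', -⟩ := hsub ⟨b, hb, rfl, hn⟩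
      exact hlast d hd ((hχ d).2 hd')
    refine realizes_desc_of_successors hL hfin hS (fun h => h.elim) htr ?_
    rintro _ ⟨b, hb, rfl⟩
    refine ⟨b, hb, rfl, fun φ _ h => .inr ?_⟩
    obtain ⟨c, hc, hφ⟩ := (mem_dia hL).1 h
    obtain ⟨d, hd, hdc⟩ := exists_R_of_E hL hb hc
    exact ⟨c, hc, hφ, desc_eq_of_E (S := S) hL hdc ▸ hreal d hd⟩

/-! ### Grzegorczyk's axiom and its monadic strengthening -/

theorem R_refl_of_T (hL : IsMonadicLogic L) (hT : ∀ φ, imp φ (dia φ) ∈ L) (a : MaxTheory L) :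
    R a a := by
  intro φ h
  by_contra hn
  obtain ⟨b, hb, h'⟩ := (mem_dia hL).1 (mem_of_imp (hT _) (mem_neg.2 hn))
  exact mem_neg.1 h' (hb _ h)

theorem R_trans_of_four (hL : IsMonadicLogic L) (h4 : ∀ φ, imp (dia (dia φ)) (dia φ) ∈ L)
    (h : R a b) (h' : R b c) : R a c := by
  intro φ hφ
  by_contra hn
  have h₁ : dia (neg φ) ∈ a := mem_of_imp (h4 _)
    ((mem_dia hL).2 ⟨b, h, (mem_dia hL).2 ⟨c, h', mem_neg.2 hn⟩⟩)
  exact mem_neg.1 hφ h₁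

/-- A point from which `φ` cannot be left and entered again. -/
theorem exists_R_final (hL : IsMonadicLogic L)
    (hgrz : ∀ φ, imp (box (imp (box (imp φ (box φ))) φ)) φ ∈ L) (hφ : φ ∈ a) :
    ∃ b, R a b ∧ φ ∈ b ∧ ∀ c d, R b c → R c d → φ ∈ d → φ ∈ c := by
  have h₁ : box (imp (box (imp (neg φ) (box (neg φ)))) (neg φ)) ∉ a :=
    fun h => mem_neg.1 (mem_of_imp (hgrz _) h) hφ
  rw [mem_box hL] at h₁
  push Not at h₁
  obtain ⟨b, hb, h₂⟩ := h₁
  rw [mem_imp hL, mem_neg] at h₂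
  push Not at h₂
  refine ⟨b, hb, h₂.2, fun c d hc hd hφd => ?_⟩
  by_contra hn
  have h₃ := (mem_imp hL).1 ((mem_box hL).1 h₂.1 c hc) (mem_neg.2 hn)
  exact mem_neg.1 ((mem_box hL).1 h₃ d hd) hφd

/-- The contrapositive of the additional axiom for the negation of `φ`. The point `c` stands for an
individual that, as long as some individual can come to satisfy `φ`, can do so itself. -/
theorem exists_R_E_of_plus (hL : IsMonadicLogic L)
    (hplus : ∀ φ, imp (box (all (imp (box (imp (box φ) (box (all φ)))) (box (all φ)))))
      (box (all φ)) ∈ L) (h : dia (ex φ) ∈ a) :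
    ∃ b c, R a b ∧ E b c ∧ dia (ex φ) ∈ c ∧ ∀ d, R c d → dia (ex φ) ∈ d → dia φ ∈ d := by
  have hd : ∀ d : MaxTheory L, box (all (neg φ)) ∈ d ↔ dia (ex φ) ∉ d := by
    intro d
    simp only [mem_box hL, mem_all hL, mem_neg, mem_dia hL, mem_ex hL]
    push Not; rfl
  have hd' : ∀ d : MaxTheory L, box (neg φ) ∈ d ↔ dia φ ∉ d := by
    intro d
    simp only [mem_box hL, mem_neg, mem_dia hL]
    push Not; rfl
  have h₁ : box (all (imp (box (imp (box (neg φ)) (box (all (neg φ))))) (box (all (neg φ))))) ∉ a :=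
    fun h' => (hd a).1 (mem_of_imp (hplus (neg φ)) h') h
  rw [mem_box hL] at h₁
  push Not at h₁
  obtain ⟨b, hb, h₂⟩ := h₁
  rw [mem_all hL] at h₂
  push Not at h₂
  obtain ⟨c, hc, h₃⟩ := h₂
  rw [mem_imp hL, hd] at h₃
  push Not at h₃
  refine ⟨b, c, hb, hc, h₃.2, fun d hcd h₄ => ?_⟩
  have h₅ := (mem_imp hL).1 ((mem_box hL).1 h₃.1 d hcd)
  rw [hd, hd'] at h₅
  tauto

/-- Every successor of `b` that may still see the description `T` has the type `t`. -/
def Stable (S : Set MForm) (T : Set (Set MForm)) (t : Set MForm) (b : MaxTheory L) : Prop :=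
  ∀ c d, R b c → R c d → desc S d = T → type S c = t

/-- The types are treated one at a time. For a type `t`, the additional axiom provides an individual
that can always regain `t` while the description remains accessible. Grzegorczyk's axiom then moves
it to a point where `t` with this description cannot be left and regained, hence is kept. The
representatives found earlier are carried along. -/
theorem exists_stable (hL : IsMonadicLogic L)
    (hT : ∀ φ, imp φ (dia φ) ∈ L) (h4 : ∀ φ, imp (dia (dia φ)) (dia φ) ∈ L)
    (hgrz : ∀ φ, imp (box (imp (box (imp φ (box φ))) φ)) φ ∈ L)
    (hplus : ∀ φ, imp (box (all (imp (box (imp (box φ) (box (all φ)))) (box (all φ)))))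
      (box (all φ)) ∈ L) (hfin : S.Finite) (a : MaxTheory L) :
    ∃ b, R a b ∧ desc S b = desc S a ∧
      ∀ t ∈ desc S a, ∃ c, E b c ∧ type S c = t ∧ Stable S (desc S a) t c := by
  have hrefl : ∀ b : MaxTheory L, R b b := R_refl_of_T hL hT
  have htr : ∀ {b c d : MaxTheory L}, R b c → R c d → R b d := R_trans_of_four hL h4
  have hdfin : (desc S a).Finite := hfin.finite_subsets.subset desc_subset
  obtain ⟨χ, hχ⟩ := exists_char_desc (L := L) hL hfin (desc_subset (S := S) (a := a))
  suffices ∀ T ⊆ desc S a, T.Finite → ∃ b, R a b ∧ desc S b = desc S a ∧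
      ∀ t ∈ T, ∃ c, E b c ∧ type S c = t ∧ Stable S (desc S a) t c from
    this _ subset_rfl hdfin
  intro T hTa hTfin
  induction T, hTfin using Set.Finite.induction_on with
  | empty => exact ⟨a, hrefl a, rfl, fun t ht => ht.elim⟩
  | @insert t T _ _ ih =>
    obtain ⟨b, hab, hb, hbT⟩ := ih fun u hu => hTa (.inr hu)
    have ht : t ∈ desc S a := hTa (.inl rfl)
    obtain ⟨θ, hθ⟩ := exists_char_type (L := L) hL hfin (desc_subset ht)
    have hq : ∀ d : MaxTheory L, MForm.and θ χ ∈ d ↔ type S d = t ∧ desc S d = desc S a :=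
      fun d => by rw [mem_and hL, hθ, hχ]
    set q := MForm.and θ χ
    have hsee : ∀ {c d : MaxTheory L}, R c d → desc S d = desc S a → dia (ex q) ∈ c := by
      intro c d hcd hd
      obtain ⟨e, he, het⟩ : t ∈ desc S d := hd ▸ ht
      exact (mem_dia hL).2 ⟨d, hcd, (mem_ex hL).2
        ⟨e, he, (hq e).2 ⟨het, (desc_eq_of_E hL he).symm.trans hd⟩⟩⟩
    obtain ⟨c, c', hbc, hcc', h₁, h₂⟩ := exists_R_E_of_plus hL hplus (hsee (hrefl b) hb)
    obtain ⟨d, hc'd, hqd⟩ := (mem_dia hL).1 (h₂ c' (hrefl c') h₁)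
    obtain ⟨e, hde, hqe, hfinal⟩ := exists_R_final hL hgrz hqd
    -- The point `e` is reached from `c'`, not from `c`; `e'` is the point of its class accessible
    -- from `c`, hence from `a`.
    obtain ⟨e', hce', hee'⟩ := exists_R_of_E hL hcc' (htr hc'd hde)
    have hstab : Stable S (desc S a) t e := by
      intro f g hef hfg hg
      obtain ⟨k, hk, hqk⟩ := (mem_dia hL).1
        (h₂ f (htr (htr hc'd hde) hef) (hsee hfg hg))
      exact ((hq f).1 (hfinal f k hef hk hqk)).1
    have he' : desc S e' = desc S a := (desc_eq_of_E hL hee').trans ((hq e).1 hqe).2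
    refine ⟨e', htr hab (htr hbc hce'), he', ?_⟩
    rintro u (rfl | hu)
    · exact ⟨e, hee', ((hq e).1 hqe).1, hstab⟩
    · obtain ⟨f, hbf, -, hf⟩ := hbT u hu
      obtain ⟨g, hfg, hge'⟩ := exists_R_of_E hL (E_symm hL hbf) (htr hbc hce')
      -- The point `g` sees its own class, which has the description of `a`, so the stability of `f`
      -- forces the type `u` on `g`.
      exact ⟨g, E_symm hL hge', hf g g hfg (hrefl g) ((desc_eq_of_E hL hge').trans he'),
        fun k l hk hl => hf k l (htr hfg hk) hl⟩

/-- Here `a` counts among its own successors, so an unrealizable description of `a` is itself a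
defect of `a`. It is not a defect of any successor at which a stable representative has changed its
type. -/
theorem realizes_desc_of_grz (hL : IsMonadicLogic L)
    (hT : ∀ φ, imp φ (dia φ) ∈ L) (h4 : ∀ φ, imp (dia (dia φ)) (dia φ) ∈ L)
    (hgrz : ∀ φ, imp (box (imp (box (imp φ (box φ))) φ)) φ ∈ L)
    (hplus : ∀ φ, imp (box (all (imp (box (imp (box φ) (box (all φ)))) (box (all φ)))))
      (box (all φ)) ∈ L) (hfin : S.Finite) (hS : SubformulaClosed S) (a : MaxTheory L) :
    ∃ n, Realizes True S n (desc S a) := by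
  induction hk : (defects True S a).ncard using Nat.strong_induction_on generalizing a with
  | _ k ih =>
    subst hk
    have hrefl : ∀ b : MaxTheory L, R b b := R_refl_of_T hL hT
    have htr : ∀ b c d : MaxTheory L, R b c → R c d → R b d := fun _ _ _ =>
      R_trans_of_four hL h4
    by_contra hn
    obtain ⟨b, hab, hb, hstab⟩ := exists_stable hL hT h4 hgrz hplus hfin (S := S) a
    refine hn ?_
    rw [← hb]
    refine realizes_desc_of_successors hL hfin hS (fun _ => hrefl) htr fun t ht => ?_
    obtain ⟨c, hbc, rfl, hc⟩ := hstab t (hb ▸ ht)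
    refine ⟨c, hbc, rfl, fun φ hφ h => ?_⟩
    by_cases hφc : φ ∈ c
    · exact .inl ⟨trivial, hφc⟩
    obtain ⟨d, hcd, hφd⟩ := (mem_dia hL).1 h
    refine .inr ⟨d, hcd, hφd, ih _ (Set.ncard_lt_ncard ⟨?_, fun hsub => ?_⟩
      (finite_defects hfin)) d rfl⟩
    · exact ((defects_subset htr hcd).trans (defects_subset_of_E hL hbc)).trans
        (defects_subset htr hab)
    -- If `d` still saw the description of `a`, stability would give it the type of `c`, although
    -- `φ` holds at `d` and fails at `c`.
    · obtain ⟨e, hde, he, -⟩ := hsub ⟨a, hrefl a, rfl, hn⟩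
      have := hc d e hcd hde he
      have hφ' : φ ∈ type S d := (mem_type (hS.dia hφ)).2 hφd
      rw [this] at hφ'
      exact hφc hφ'.2

end MaxTheory
end MonadicModal

namespace MonadicModal

/-! ### Kripke semantics of propositional modal logic -/

namespace PForm

/-- Truth at a world of a Kripke model. -/
def Sat {W : Type} (R : W → W → Prop) (V : ℕ → W → Prop) : PForm → W → Prop
  | letter p, w => V p w
  | neg φ, w => ¬ Sat R V φ w
  | or φ ψ, w => Sat R V φ w ∨ Sat R V ψ w
  | dia φ, w => ∃ v, R w v ∧ Sat R V φ v

/-- Validity on a Kripke frame. -/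
def Valid {W : Type} (R : W → W → Prop) (φ : PForm) : Prop := ∀ V w, Sat R V φ w

variable {W : Type} {R : W → W → Prop} {V : ℕ → W → Prop} {φ ψ : PForm} {w : W}

theorem sat_imp : Sat R V (imp φ ψ) w ↔ (Sat R V φ w → Sat R V ψ w) := by
  simp only [imp, Sat]; tauto

theorem sat_and : Sat R V (and φ ψ) w ↔ (Sat R V φ w ∧ Sat R V ψ w) := by
  simp only [PForm.and, Sat]; tauto

theorem sat_box : Sat R V (box φ) w ↔ ∀ v, R w v → Sat R V φ v := by
  simp only [box, Sat]; push Not; rfl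

theorem sat_subst (p : ℕ) (ψ φ : PForm) (w : W) :
    Sat R V (subst p ψ φ) w ↔ Sat R (Function.update V p (Sat R V ψ)) φ w := by
  induction φ generalizing w with
  | letter q => by_cases h : q = p <;> simp [subst, Sat, h]
  | _ => simp_all [subst, Sat]

theorem valid_of_mem_pclosure {G : Set PForm} (h : ∀ φ ∈ G, Valid R φ) (hφ : φ ∈ PClosure G) :
    Valid R φ := by
  induction hφ with
  | base h' => exact h _ h'
  | mp _ _ ih₁ ih₂ => exact fun V w => sat_imp.1 (ih₂ V w) (ih₁ V w)
  | nec _ ih => exact fun V w => sat_box.2 fun v _ => ih V v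
  | subst p ψ _ ih => exact fun V w => (sat_subst _ _ _ _).2 (ih _ w)

theorem valid_of_mem_logicK (hφ : φ ∈ logicK) : Valid R φ := by
  refine valid_of_mem_pclosure ?_ hφ
  rintro φ (h | rfl | rfl) V w
  · exact h (fun α => Sat R V α w) (fun _ => Iff.rfl) (fun _ _ => Iff.rfl)
  · simp only [sat_imp, sat_box]
    exact fun h₁ h₂ v hv => h₁ v hv (h₂ v hv)
  · simp only [iff, sat_and, sat_imp, Sat, sat_box]
    push Not
    exact ⟨id, id⟩

theorem valid_of_mem_logicGL (htr : ∀ u v w, R u v → R v w → R u w)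
    (hwf : WellFounded (fun v w => R w v)) (hφ : φ ∈ logicGL) : Valid R φ := by
  refine valid_of_mem_pclosure ?_ hφ
  rintro φ (rfl | h) V w
  · simp only [sat_imp, sat_box]
    intro h v
    induction v using hwf.induction with
    | _ v ih => exact fun hv => h v hv fun u hu => ih u hu (htr _ _ _ hv hu)
  · exact valid_of_mem_logicK h V w

theorem valid_of_mem_logicGrz (htr : ∀ u v w, R u v → R v w → R u w)
    (hwf : WellFounded (fun v w => R w v)) (hφ : φ ∈ logicGrz) :
    Valid (fun w v => R w v ∨ w = v) φ := by
  refine valid_of_mem_pclosure ?_ hφ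
  rintro φ (rfl | h)
  · intro V w
    simp only [sat_imp, sat_box]
    intro h
    suffices ∀ v, (R w v ∨ w = v) → Sat (fun w v => R w v ∨ w = v) V (letter 0) v from
      this w (.inr rfl)
    intro v
    induction v using hwf.induction with
    | _ v ih =>
      intro hv
      have hw : ∀ u, R v u → R w u := fun u hu =>
        hv.elim (fun h => htr _ _ _ h hu) (fun h => h ▸ hu)
      by_contra hn
      refine hn (h v hv fun u hu hsat x hx => ?_)
      rcases hu with hu | rfl
      · rcases hx with hx | rfl
        · exact ih x (htr _ _ _ hu hx) (.inl (hw x (htr _ _ _ hu hx)))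
        · exact hsat
      · exact (hn hsat).elim
  · refine valid_of_mem_pclosure ?_ h
    rintro φ (h | rfl | rfl)
    · exact valid_of_mem_logicK h
    · intro V w
      rw [sat_imp]
      exact fun h => ⟨w, .inr rfl, h⟩
    · intro V w
      rw [sat_imp]
      rintro ⟨v, hv, u, hu, h⟩
      refine ⟨u, ?_, h⟩
      rcases hv with hv | rfl
      · rcases hu with hu | rfl
        · exact .inl (htr _ _ _ hv hu)
        · exact .inl hv
      · exact hu

end PForm

/-! ### Kripke semantics of predicate modal logic -/

/-- A Kripke frame with individuals: an arrow from a world to another one is a function between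
their domains. -/
structure QFrame where
  World : Type
  Dom : World → Type
  Arrow : ∀ w v : World, (Dom w → Dom v) → Prop

namespace QFrame

/-- Interpretations of the predicates. They may depend on a tuple of parameters, which moves along
the arrows. -/
abbrev Interp (F : QFrame) (P : Type) : Type :=
  ∀ w : F.World, (P → F.Dom w) → ∀ n : ℕ, ℕ → (Fin n → F.Dom w) → Prop

variable {F : QFrame} {P : Type}

/-- Truth at a world under an assignment. -/
def Sat (I : F.Interp P) : QForm → ∀ w : F.World, (P → F.Dom w) → (ℕ → F.Dom w) → Prop
  | .atom n k y, w, ρ, σ => I w ρ n k (σ ∘ y)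
  | .neg φ, w, ρ, σ => ¬ Sat I φ w ρ σ
  | .or φ ψ, w, ρ, σ => Sat I φ w ρ σ ∨ Sat I ψ w ρ σ
  | .dia φ, w, ρ, σ => ∃ v f, F.Arrow w v f ∧ Sat I φ v (f ∘ ρ) (f ∘ σ)
  | .ex x φ, w, ρ, σ => ∃ d, Sat I φ w ρ (Function.update σ x d)

/-- Validity on a frame. -/
def Valid (F : QFrame) (φ : QForm) : Prop :=
  ∀ (P : Type) (I : F.Interp P) w ρ σ, Sat I φ w ρ σ

variable {I : F.Interp P} {w : F.World} {ρ : P → F.Dom w} {σ : ℕ → F.Dom w} {φ ψ : QForm}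

theorem sat_imp : Sat I (φ.imp ψ) w ρ σ ↔ (Sat I φ w ρ σ → Sat I ψ w ρ σ) := by
  simp only [QForm.imp, Sat]; tauto

theorem sat_box : Sat I φ.box w ρ σ ↔ ∀ v f, F.Arrow w v f → Sat I φ v (f ∘ ρ) (f ∘ σ) := by
  simp only [QForm.box, Sat]; push Not; rfl

theorem sat_all {x : ℕ} : Sat I (φ.all x) w ρ σ ↔ ∀ d, Sat I φ w ρ (Function.update σ x d) := by
  simp only [QForm.all, Sat]; push Not; rfl

theorem comp_update {A B : Type} (f : A → B) (σ : ℕ → A) (x : ℕ) (d : A) :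
    f ∘ Function.update σ x d = Function.update (f ∘ σ) x (f d) :=
  Function.comp_update f σ x d

theorem sat_congr {w : F.World} {ρ : P → F.Dom w} {σ τ : ℕ → F.Dom w}
    (h : ∀ i ∈ φ.fv, σ i = τ i) : Sat I φ w ρ σ ↔ Sat I φ w ρ τ := by
  induction φ generalizing w with
  | atom n k y =>
    have : σ ∘ y = τ ∘ y := funext fun i => h _ (by simp [QForm.fv])
    simp only [Sat, this]
  | neg φ ih => exact not_congr (ih h)
  | or φ ψ ih₁ ih₂ =>
    exact or_congr (ih₁ fun i hi => h i (Finset.mem_union_left _ hi))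
      (ih₂ fun i hi => h i (Finset.mem_union_right _ hi))
  | dia φ ih =>
    exact exists_congr fun v => exists_congr fun f => and_congr_right fun _ =>
      ih fun i hi => congrArg f (h i hi)
  | ex x φ ih =>
    refine exists_congr fun d => ih fun i hi => ?_
    by_cases hx : i = x
    · simp [hx]
    · simp only [Function.update_of_ne hx]
      exact h i (Finset.mem_erase.2 ⟨hx, hi⟩)

theorem avoid_notMem (S : Finset ℕ) (x : ℕ) : QForm.avoid S x ∉ S := by
  unfold QForm.avoid
  split_ifs with h
  · intro h'
    exact Nat.not_succ_le_self _ (Finset.le_sup (f := id) h')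
  · exact h

theorem sat_vsubst (τ : ℕ → ℕ) (φ : QForm) (w : F.World) (ρ : P → F.Dom w) (σ : ℕ → F.Dom w) :
    Sat I (QForm.vsubst τ φ) w ρ σ ↔ Sat I φ w ρ (σ ∘ τ) := by
  induction φ generalizing w τ with
  | atom n k y => exact Iff.rfl
  | neg φ ih => exact not_congr (ih ..)
  | or φ ψ ih₁ ih₂ => exact or_congr (ih₁ ..) (ih₂ ..)
  | dia φ ih =>
    exact exists_congr fun v => exists_congr fun f => and_congr_right fun _ => ih ..
  | ex x φ ih =>
    refine exists_congr fun d => (ih ..).trans (sat_congr fun i hi => ?_)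
    by_cases hx : i = x
    · simp [hx]
    · simp only [Function.comp_apply, Function.update_of_ne hx]
      refine Function.update_of_ne (fun h => ?_) _ _
      refine avoid_notMem (((φ.fv).erase x).image τ) x ?_
      rw [← h]
      exact Finset.mem_image_of_mem τ (Finset.mem_erase.2 ⟨hx, hi⟩)

open Classical in
/-- The interpretation in which the predicate `P^m_j` is interpreted by the formula `ψ`. -/
def substInterp (I : F.Interp P) {m : ℕ} (j : ℕ) (x : Fin m → ℕ) (ψ : QForm) :
    F.Interp (P ⊕ ℕ) := fun w ρ n k a =>
  if h : n = m ∧ k = j then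
    Sat I ψ w (ρ ∘ Sum.inl)
      (Function.extend x (fun i => a (Fin.cast h.1.symm i)) (ρ ∘ Sum.inr))
  else I w (ρ ∘ Sum.inl) n k a

/-- The free variables of `ψ` outside `x` keep their values when quantifiers of `φ` are passed, and
these values move along arrows. They are therefore stored in the parameters of `substInterp`, as
`σ₀`. -/
theorem sat_psubstAux {m : ℕ} (j : ℕ) {x : Fin m → ℕ} (hx : Function.Injective x) (ψ : QForm)
    (τ : ℕ → ℕ) (φ : QForm) (w : F.World) (ρ : P → F.Dom w) (σ σ₀ : ℕ → F.Dom w)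
    (hσ : ∀ i ∈ ψ.fv \ Finset.univ.image x, σ i = σ₀ i) :
    Sat I (QForm.psubstAux j x ψ τ φ) w ρ σ ↔
      Sat (substInterp I j x ψ) φ w (Sum.elim ρ σ₀) (σ ∘ τ) := by
  induction φ generalizing w τ with
  | atom n k y =>
    by_cases h : n = m ∧ k = j
    · obtain ⟨rfl, rfl⟩ := h
      simp only [QForm.psubstAux, Sat, substInterp, and_self, dite_true]
      rw [sat_vsubst, Sum.elim_comp_inl, Sum.elim_comp_inr]
      refine sat_congr fun i hi => ?_
      by_cases hi' : ∃ k, x k = i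
      · obtain ⟨k, rfl⟩ := hi'
        simp [hx.extend_apply]
      · rw [Function.comp_apply, Function.extend_apply' _ _ _ hi',
          Function.extend_apply' _ _ _ hi']
        exact hσ i (by simpa [hi] using hi')
    · simp only [QForm.psubstAux, Sat, substInterp, h, dite_false, Sum.elim_comp_inl]
      exact Iff.rfl
  | neg φ ih => exact not_congr (ih _ _ _ _ _ hσ)
  | or φ χ ih₁ ih₂ => exact or_congr (ih₁ _ _ _ _ _ hσ) (ih₂ _ _ _ _ _ hσ)
  | dia φ ih =>
    refine exists_congr fun v => exists_congr fun f => and_congr_right fun _ => ?_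
    rw [ih τ v (f ∘ ρ) (f ∘ σ) (f ∘ σ₀) fun i hi => congrArg f (hσ i hi), Sum.comp_elim]
    exact Iff.rfl
  | ex u φ ih =>
    refine exists_congr fun d => ?_
    have hz := avoid_notMem ((φ.fv.erase u).image τ ∪ (ψ.fv \ Finset.univ.image x)) u
    rw [Finset.mem_union, not_or] at hz
    rw [ih _ _ _ _ σ₀]
    · refine sat_congr fun i hi => ?_
      by_cases hiu : i = u
      · simp [hiu]
      · simp only [Function.comp_apply, Function.update_of_ne hiu]
        refine Function.update_of_ne (fun h => hz.1 ?_) _ _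
        rw [← h]
        exact Finset.mem_image_of_mem τ (Finset.mem_erase.2 ⟨hiu, hi⟩)
    · intro i hi
      rw [Function.update_of_ne (by rintro rfl; exact hz.2 hi), hσ i hi]

theorem valid_of_mem_qclosure {G : Set QForm} (h : ∀ φ ∈ G, F.Valid φ)
    (hφ : φ ∈ QClosure G) : F.Valid φ := by
  induction hφ with
  | base h' => exact h _ h'
  | mp _ _ ih₁ ih₂ => exact fun P I w ρ σ => sat_imp.1 (ih₂ P I w ρ σ) (ih₁ P I w ρ σ)
  | nec _ ih => exact fun P I w ρ σ => sat_box.2 fun v f _ => ih P I v _ _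
  | gen x _ ih => exact fun P I w ρ σ => sat_all.2 fun d => ih P I w _ _
  | subst j x ψ hx _ ih =>
    exact fun P I w ρ σ => (sat_psubstAux j hx ψ id _ w ρ σ σ fun _ _ => rfl).2 (ih _ _ w _ _)

theorem valid_of_classicalAx (h : φ ∈ QForm.ClassicalAx) : F.Valid φ := by
  intro P I w ρ σ
  have hupd : ∀ x y, σ ∘ Function.update id x y = Function.update σ x (σ y) :=
    fun x y => comp_update σ id x y
  cases h with
  | taut h => exact h (fun α => Sat I α w ρ σ) (fun _ => Iff.rfl) (fun _ _ => Iff.rfl)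
  | allElim x y φ =>
    rw [sat_imp, sat_all, sat_vsubst, hupd]
    exact fun h => h _
  | exIntro x y φ =>
    rw [sat_imp, sat_vsubst, hupd]
    exact fun h => ⟨_, h⟩
  | allDistrib x φ ψ hx =>
    simp only [sat_imp, sat_all]
    refine fun h h' d => h d ((sat_congr fun i hi => ?_).2 h')
    rw [Function.update_of_ne (by rintro rfl; exact hx hi)]
  | exDistrib x φ ψ hx =>
    simp only [sat_imp, sat_all]
    rintro h ⟨d, h'⟩
    refine (sat_congr fun i hi => ?_).1 (h d h')
    rw [Function.update_of_ne (by rintro rfl; exact hx hi)]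

/-- A world with parameters and an assignment. -/
abbrev State (F : QFrame) (P : Type) : Type :=
  Σ w : F.World, (P → F.Dom w) × (ℕ → F.Dom w)

/-- The accessibility relation between states. -/
def StateRel (F : QFrame) (P : Type) (a b : F.State P) : Prop :=
  ∃ f, F.Arrow a.1 b.1 f ∧ b.2 = (f ∘ a.2.1, f ∘ a.2.2)

/-- Interpretations of `0`-ary predicates may depend on the parameters, so the propositional model
lives on states rather than on worlds. -/
theorem sat_ofPForm (χ : PForm) (w : F.World) (ρ : P → F.Dom w) (σ : ℕ → F.Dom w) :
    Sat I (QForm.ofPForm χ) w ρ σ ↔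
      PForm.Sat (F.StateRel P) (fun p a => I a.1 a.2.1 0 p Fin.elim0) χ ⟨w, ρ, σ⟩ := by
  induction χ generalizing w with
  | letter p =>
    have : σ ∘ Fin.elim0 = Fin.elim0 := Subsingleton.elim _ _
    simp only [QForm.ofPForm, Sat, PForm.Sat, this]
  | neg φ ih => exact not_congr (ih ..)
  | or φ ψ ih₁ ih₂ => exact or_congr (ih₁ ..) (ih₂ ..)
  | dia φ ih =>
    constructor
    · rintro ⟨v, f, hf, h⟩
      exact ⟨⟨v, _, _⟩, ⟨f, hf, rfl⟩, (ih ..).1 h⟩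
    · rintro ⟨⟨v, τ⟩, ⟨f, hf, h'⟩, h⟩
      refine ⟨v, f, hf, (ih ..).2 ?_⟩
      rwa [show τ = (f ∘ ρ, f ∘ σ) from h'] at h

/-- Transitive and conversely well-founded frames. -/
structure IsNoetherian (F : QFrame) : Prop where
  comp : ∀ {u v w f g}, F.Arrow u v f → F.Arrow v w g → F.Arrow u w (g ∘ f)
  wf : WellFounded (fun v w => ∃ f, F.Arrow w v f)

theorem IsNoetherian.stateRel_trans (hF : F.IsNoetherian) (a b c : F.State P)
    (h : F.StateRel P a b) (h' : F.StateRel P b c) : F.StateRel P a c := by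
  obtain ⟨f, hf, h₁⟩ := h
  obtain ⟨g, hg, h₂⟩ := h'
  refine ⟨g ∘ f, hF.comp hf hg, ?_⟩
  rw [h₂, h₁]; rfl

theorem IsNoetherian.stateRel_wf (hF : F.IsNoetherian) :
    WellFounded (fun b a => F.StateRel P a b) :=
  Subrelation.wf (fun ⟨f, hf, _⟩ => ⟨f, hf⟩) (InvImage.wf Sigma.fst hF.wf)

theorem valid_of_mem_QGL (hF : F.IsNoetherian) (hφ : φ ∈ QGL) : F.Valid φ := by
  refine valid_of_mem_qclosure ?_ hφ
  rintro φ (h | ⟨χ, hχ, rfl⟩)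
  · exact valid_of_classicalAx h
  · intro P I w ρ σ
    exact (sat_ofPForm ..).2
      (PForm.valid_of_mem_logicGL hF.stateRel_trans hF.stateRel_wf hχ _ _)

/-- Arrows of the reflexive closure of a frame. -/
inductive ReflArrow (F : QFrame) : ∀ w v : F.World, (F.Dom w → F.Dom v) → Prop
  | arrow {w v f} : F.Arrow w v f → ReflArrow F w v f
  | refl (w : F.World) : ReflArrow F w w id

/-- The reflexive closure of a frame. -/
abbrev refl (F : QFrame) : QFrame := ⟨F.World, F.Dom, F.ReflArrow⟩

theorem stateRel_refl (a b : F.State P) :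
    F.refl.StateRel P a b ↔ F.StateRel P a b ∨ a = b := by
  constructor
  · obtain ⟨w, ρ, σ⟩ := a
    obtain ⟨v, τ⟩ := b
    rintro ⟨f, hf, h⟩
    have hf : F.ReflArrow w v f := hf
    cases hf with
    | arrow hf => exact .inl ⟨f, hf, h⟩
    | refl =>
      obtain rfl : τ = (ρ, σ) := h
      exact .inr rfl
  · rintro (⟨f, hf, h⟩ | rfl)
    · exact ⟨f, .arrow hf, h⟩
    · exact ⟨id, .refl _, rfl⟩

theorem IsNoetherian.arrow_refl_comp (hF : F.IsNoetherian) {u v w f g}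
    (hf : F.Arrow u v f) (hg : F.ReflArrow v w g) : F.Arrow u w (g ∘ f) := by
  cases hg with
  | arrow hg => exact hF.comp hf hg
  | refl => exact hf

theorem IsNoetherian.refl_comp (hF : F.IsNoetherian) {u v w f g}
    (hf : F.ReflArrow u v f) (hg : F.ReflArrow v w g) : F.ReflArrow u w (g ∘ f) := by
  cases hf with
  | arrow hf => exact .arrow (hF.arrow_refl_comp hf hg)
  | refl => exact hg

/-- Induction from the top: suppose `∀xP` fails at `v` because of `d`, but holds at all proper
successors. Then `□P(d) → □∀xP` holds at `v`, whose premise is false there, and at all proper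
successors. The hypothesis for `d` yields `□∀xP` at `v`, a contradiction. -/
theorem valid_plusFormula (hF : F.IsNoetherian) : F.refl.Valid QForm.plusFormula := by
  intro P I w ρ σ
  rw [QForm.plusFormula, sat_imp]
  intro h
  rw [sat_box] at h ⊢
  intro v
  induction v using hF.wf.induction with
  | _ v ih =>
    intro f hf
    by_contra hn
    have hn' := hn
    rw [sat_all] at hn'
    push Not at hn'
    obtain ⟨d, hd⟩ := hn'
    have hclosed : ∀ {v : F.refl.World} {ρ : P → F.Dom v} {σ τ : ℕ → F.Dom v},
        Sat (F := F.refl) I (QForm.all 0 (.atom 1 0 fun _ => 0)) v ρ σ →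
          Sat I (QForm.all 0 (.atom 1 0 fun _ => 0)) v ρ τ := fun h =>
      (sat_congr (by simp [QForm.fv, QForm.all])).1 h
    have h₁ := sat_all.1 (h v f hf) d
    rw [sat_imp, sat_box, sat_box] at h₁
    suffices ∀ (u : F.World) (g : F.Dom v → F.Dom u), F.ReflArrow v u g → _ from
      hn (hclosed (h₁ this v id (.refl v)))
    intro u g hg
    rw [sat_imp, sat_box, sat_box]
    intro h₂ t k hk
    cases hg with
    | refl => exact (hd (h₂ v id (.refl v))).elim
    | arrow hg =>
      have hk' : F.Arrow v t (k ∘ g) := hF.arrow_refl_comp hg hk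
      have hf' : F.ReflArrow w t ((k ∘ g) ∘ f) := hF.refl_comp hf (.arrow hk')
      exact hclosed (ih t ⟨_, hk'⟩ _ hf')

theorem valid_of_mem_QPlusGrz (hF : F.IsNoetherian) (hφ : φ ∈ QPlusGrz) : F.refl.Valid φ := by
  refine valid_of_mem_qclosure ?_ hφ
  rintro φ (rfl | h)
  · exact valid_plusFormula hF
  refine valid_of_mem_qclosure ?_ h
  rintro φ (h | ⟨χ, hχ, rfl⟩)
  · exact valid_of_classicalAx h
  · intro P I w ρ σ
    have h := PForm.valid_of_mem_logicGrz (hF.stateRel_trans (P := P)) hF.stateRel_wf hχ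
    have h' : (fun a b => F.StateRel P a b ∨ a = b) = F.refl.StateRel P :=
      funext fun a => funext fun b => propext (stateRel_refl a b).symm
    rw [h'] at h
    exact (sat_ofPForm ..).2 (h _ _)

end QFrame
end MonadicModal

namespace MonadicModal
open MForm

/-! ### Frames of types -/

/-- The frame of the realized sets of types. -/
def typeFrame (r : Prop) (S : Set MForm) : QFrame where
  World := {p : ℕ × Set (Set MForm) // Realizes r S p.1 p.2}
  Dom w := w.1.2
  Arrow w v f := v.1.1 < w.1.1 ∧ ∀ u, Compat S u.1 (f u).1

/-- Composition works because `Compat` also pulls back formulas `◇φ`, not only `φ`. -/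
theorem Compat.trans {S t u v : Set MForm} (h : Compat S t u) (h' : Compat S u v) :
    Compat S t v := fun φ hφ h'' => h φ hφ (.inr (h' φ hφ h''))

theorem isNoetherian_typeFrame (r : Prop) (S : Set MForm) : (typeFrame r S).IsNoetherian :=
  ⟨fun hf hg => ⟨hg.1.trans hf.1, fun u => (hf.2 u).trans (hg.2 _)⟩,
    Subrelation.wf (fun ⟨_, h⟩ => h.1)
      (InvImage.wf (fun w : (typeFrame r S).World => w.1.1) Nat.lt_wfRel.wf)⟩

/-- Each letter is true of the types that contain it. -/
def typeInterp (r : Prop) (S : Set MForm) (s : ℕ → ℕ) : (typeFrame r S).Interp Empty :=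
  fun _ _ n k a => ∃ p, s p = k ∧ ∃ h : n = 1, letter p ∈ (a (Fin.cast h.symm 0)).1

theorem Realizes.coherent {r : Prop} {S : Set MForm} {n : ℕ} {T : Set (Set MForm)}
    (h : Realizes r S n T) : Coherent r S T := by
  cases n with
  | zero => exact h.elim
  | succ n => exact h.1

/-- Truth lemma for frames that extend `typeFrame r S`, with identity arrows if `r` holds. -/
theorem sat_transl_typeFrame {r : Prop} {S : Set MForm} (hS : SubformulaClosed S) (x : ℕ)
    {s : ℕ → ℕ} (hs : Function.Injective s)
    (A : ∀ w v : (typeFrame r S).World,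
      ((typeFrame r S).Dom w → (typeFrame r S).Dom v) → Prop)
    (hA : ∀ w v f, (typeFrame r S).Arrow w v f → A w v f)
    (hr : r → ∀ w, A w w id)
    (hA' : ∀ w v f, A w v f → ∀ u, Compat S u.1 (f u).1 ∨
      (r ∧ (f u).1 = u.1))
    {φ : MForm} (hφ : φ ∈ S) (w : (typeFrame r S).World) (ρ : Empty → (typeFrame r S).Dom w)
    (σ : ℕ → (typeFrame r S).Dom w) :
    QFrame.Sat (F := ⟨_, (typeFrame r S).Dom, A⟩) (typeInterp r S s) (transl x s φ) w ρ σ ↔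
      φ ∈ (σ x).1 := by
  induction φ generalizing w with
  | letter p =>
    constructor
    · rintro ⟨q, hq, h₁, h⟩
      obtain rfl := hs hq
      exact h
    · exact fun h => ⟨p, rfl, rfl, h⟩
  | neg φ ih =>
    exact (not_congr (ih (hS.neg hφ) ..)).trans (w.2.coherent.neg _ (σ x).2 hφ).symm
  | or φ ψ ih₁ ih₂ =>
    exact (or_congr (ih₁ (hS.or hφ).1 ..) (ih₂ (hS.or hφ).2 ..)).trans
      (w.2.coherent.or _ (σ x).2 hφ).symm
  | ex φ ih =>
    refine Iff.trans ?_ (w.2.coherent.ex _ (σ x).2 hφ).symm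
    constructor
    · rintro ⟨d, h⟩
      have := (ih (hS.ex hφ) ..).1 h
      rw [Function.update_self] at this
      exact ⟨d.1, d.2, this⟩
    · rintro ⟨u, hu, h⟩
      let d : (typeFrame r S).Dom w := ⟨u, hu⟩
      have hd : Function.update σ x d x = d := Function.update_self ..
      refine ⟨d, (ih (hS.ex hφ) ..).2 ?_⟩
      rw [hd]
      exact h
  | dia φ ih =>
    constructor
    · rintro ⟨v, f, hf, h⟩
      have h' := (ih (hS.dia hφ) v _ (f ∘ σ)).1 h
      rcases hA' w v f hf (σ x) with hc | ⟨h₁, h₂⟩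
      · exact hc φ hφ (.inl h')
      · exact w.2.coherent.dia h₁ _ (σ x).2 hφ (h₂ ▸ h')
    · intro h
      obtain ⟨⟨n, T⟩, hw⟩ := w
      -- Witnesses are realized with the predecessor of the rank, so the arrow to them strictly
      -- lowers it.
      cases n with
      | zero => exact hw.elim
      | succ n =>
        rcases hw.2 (σ x) φ hφ h with ⟨h₁, h₂⟩ | ⟨U, hU, f, hf, h₂⟩
        · exact ⟨_, id, hr h₁ _, (ih (hS.dia hφ) ..).2 h₂⟩
        · exact ⟨⟨(n, U), hU⟩, f, hA _ _ _ ⟨Nat.lt_succ_self n, hf⟩,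
            (ih (hS.dia hφ) ..).2 h₂⟩

theorem sat_transl_iff {S : Set MForm} (hS : SubformulaClosed S) (x : ℕ)
    {s : ℕ → ℕ} (hs : Function.Injective s) {φ : MForm} (hφ : φ ∈ S)
    (w : (typeFrame False S).World) (ρ : Empty → (typeFrame False S).Dom w)
    (σ : ℕ → (typeFrame False S).Dom w) :
    QFrame.Sat (typeInterp False S s) (transl x s φ) w ρ σ ↔ φ ∈ (σ x).1 :=
  sat_transl_typeFrame hS x hs _ (fun _ _ _ h => h) (fun h => h.elim)
    (fun _ _ _ h u => .inl (h.2 u)) hφ w ρ σ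

theorem sat_transl_refl_iff {S : Set MForm} (hS : SubformulaClosed S) (x : ℕ)
    {s : ℕ → ℕ} (hs : Function.Injective s) {φ : MForm} (hφ : φ ∈ S)
    (w : (typeFrame True S).World) (ρ : Empty → (typeFrame True S).Dom w)
    (σ : ℕ → (typeFrame True S).Dom w) :
    QFrame.Sat (F := (typeFrame True S).refl) (typeInterp True S s) (transl x s φ) w ρ σ ↔
      φ ∈ (σ x).1 := by
  refine sat_transl_typeFrame hS x hs _ (fun _ _ _ h => .arrow h) (fun _ w => .refl w) ?_ hφ w ρ σ
  intro w v f h u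
  cases h with
  | arrow h => exact .inl (h.2 u)
  | refl => exact .inr ⟨trivial, rfl⟩

/-! ### The logics contain the monadic fragments -/

theorem Derives.mem {L : Set MForm} (hL : IsMonadicLogic L) {φ : MForm}
    (d : Derives L ∅ φ) : φ ∈ L := by
  induction d with
  | hyp h => exact h.elim
  | ax h => exact h
  | mp _ _ ih₁ ih₂ => exact hL.mp ih₁ ih₂

theorem IsMonadicLogic.exists_notMem {L : Set MForm} (hL : IsMonadicLogic L) {φ : MForm}
    (h : φ ∉ L) : ∃ a : MaxTheory L, φ ∉ a :=
  let ⟨a, _, ha⟩ := exists_maxTheory hL fun d => h (d.mem hL)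
  ⟨a, ha⟩

theorem isMonadicLogic_MGL : IsMonadicLogic MGL :=
  isMonadicLogic_mclosure (by
    rintro φ ((⟨χ, hχ, rfl⟩ | h) | h)
    · exact .base (.inl (.inl ⟨χ, .base (.inr hχ), rfl⟩))
    · exact .base (.inl (.inr h))
    · exact .base (.inr h))

theorem isMonadicLogic_MPlusGrz : IsMonadicLogic MPlusGrz :=
  isMonadicLogic_mclosure (by
    rintro φ ((⟨χ, hχ, rfl⟩ | h) | h)
    · exact .base (.inr (.base (.inl (.inl
        ⟨χ, .base (.inr (.base (.inl hχ))), rfl⟩))))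
    · exact .base (.inr (.base (.inl (.inr h))))
    · exact .base (.inr (.base (.inr h))))

theorem mem_MPlusGrz_of_mem_logicGrz {χ : PForm} (h : χ ∈ logicGrz) : ofPForm χ ∈ MPlusGrz :=
  .base (.inr (.base (.inl (.inl ⟨χ, h, rfl⟩))))

theorem mem_MGL_of_transl_mem (x : ℕ) {s : ℕ → ℕ} (hs : Function.Injective s) {φ : MForm}
    (h : transl x s φ ∈ QGL) : φ ∈ MGL := by
  by_contra hn
  obtain ⟨a, ha⟩ := isMonadicLogic_MGL.exists_notMem hn
  have hL := isMonadicLogic_MGL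
  obtain ⟨n, hreal⟩ := MaxTheory.realizes_desc_of_loeb hL
    (fun φ => hL.msub_mem (substThree φ φ φ)
      (.base (.inl (.inl ⟨_, .base (.inl rfl), rfl⟩))))
    φ.finite_subformulas φ.subformulaClosed_subformulas a
  have hsat := QFrame.valid_of_mem_QGL (isNoetherian_typeFrame False φ.subformulas) h Empty
    (typeInterp False _ s) ⟨(n, _), hreal⟩ Empty.elim
    (fun _ => ⟨_, MaxTheory.type_mem_desc hL⟩)
  exact ha ((sat_transl_iff φ.subformulaClosed_subformulas x hs φ.mem_subformulas_self _ _ _).1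
    hsat).2

theorem mem_MPlusGrz_of_transl_mem (x : ℕ) {s : ℕ → ℕ} (hs : Function.Injective s) {φ : MForm}
    (h : transl x s φ ∈ QPlusGrz) : φ ∈ MPlusGrz := by
  by_contra hn
  obtain ⟨a, ha⟩ := isMonadicLogic_MPlusGrz.exists_notMem hn
  have hL := isMonadicLogic_MPlusGrz
  obtain ⟨n, hreal⟩ := MaxTheory.realizes_desc_of_grz hL
    (fun φ => hL.msub_mem (substThree φ φ φ)
      (mem_MPlusGrz_of_mem_logicGrz (.base (.inr (.base (.inr (.inl rfl)))))))
    (fun φ => hL.msub_mem (substThree φ φ φ)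
      (mem_MPlusGrz_of_mem_logicGrz (.base (.inr (.base (.inr (.inr rfl)))))))
    (fun φ => hL.msub_mem (substThree φ φ φ)
      (mem_MPlusGrz_of_mem_logicGrz (.base (.inl rfl))))
    (fun φ => hL.msub_mem (substThree φ φ φ) (.base (.inl rfl)))
    φ.finite_subformulas φ.subformulaClosed_subformulas a
  have hsat := QFrame.valid_of_mem_QPlusGrz (isNoetherian_typeFrame True φ.subformulas) h Empty
    (typeInterp True _ s) ⟨(n, _), hreal⟩ Empty.elim
    (fun _ => ⟨_, MaxTheory.type_mem_desc hL⟩)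
  exact ha ((sat_transl_refl_iff φ.subformulaClosed_subformulas x hs φ.mem_subformulas_self _ _
    _).1 hsat).2

end MonadicModal

/-! ### Translations of theorems are derivable in the predicate logics. -/

namespace MonadicModal

namespace QForm

theorem avoid_of_notMem {S : Finset ℕ} {x : ℕ} (h : x ∉ S) : avoid S x = x := if_neg h

theorem vsubst_id (φ : QForm) : vsubst id φ = φ := by
  induction φ with
  | atom n k y => rfl
  | ex x φ ih =>
    have h : avoid ((φ.fv.erase x).image id) x = x := avoid_of_notMem (by simp)
    simp only [vsubst, h]
    rw [show Function.update (id : ℕ → ℕ) x x = id from Function.update_eq_self x id, ih]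
  | _ => simp_all [vsubst]

/-- Bound variables. -/
def bv : QForm → Finset ℕ
  | atom _ _ _ => ∅
  | neg φ => bv φ
  | or φ ψ => bv φ ∪ bv ψ
  | dia φ => bv φ
  | ex x φ => insert x (bv φ)

/-- No propositional letter occurs in the formula. -/
def NoLetter : QForm → Prop
  | atom n _ _ => n ≠ 0
  | neg φ => NoLetter φ
  | or φ ψ => NoLetter φ ∧ NoLetter ψ
  | dia φ => NoLetter φ
  | ex _ φ => NoLetter φ

/-- Substitution of predicate formulas for the letters of a propositional formula. -/
def inst (σ : ℕ → QForm) : PForm → QForm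
  | .letter p => σ p
  | .neg φ => neg (inst σ φ)
  | .or φ ψ => or (inst σ φ) (inst σ ψ)
  | .dia φ => dia (inst σ φ)

theorem inst_congr {N : ℕ} {σ τ : ℕ → QForm} (h : ∀ j < N, σ j = τ j) {χ : PForm}
    (hχ : (MForm.ofPForm χ).LettersLT N) : inst σ χ = inst τ χ := by
  induction χ with
  | letter p => exact h p hχ
  | neg φ ih => exact congrArg neg (ih hχ)
  | or φ ψ ih₁ ih₂ => exact congrArg₂ or (ih₁ hχ.1) (ih₂ hχ.2)
  | dia φ ih => exact congrArg dia (ih hχ)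

theorem inst_letters (χ : PForm) : inst (fun p => atom 0 p Fin.elim0) χ = ofPForm χ := by
  induction χ <;> simp_all [inst, ofPForm]

theorem psubst_inst {m : ℕ} (j : ℕ) (x : Fin m → ℕ) (ψ : QForm) (σ : ℕ → QForm) (χ : PForm) :
    psubst j x ψ (inst σ χ) = inst (fun p => psubst j x ψ (σ p)) χ := by
  unfold psubst
  induction χ <;> simp_all [inst, psubstAux]

/-- Even where nothing is replaced, `psubst` renames bound variables that are free in `ψ`; the
disjointness excludes this. -/
theorem psubst_of_noLetter (j : ℕ) (x : Fin 0 → ℕ) {ψ φ : QForm} (hφ : φ.NoLetter)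
    (hd : Disjoint φ.bv ψ.fv) : psubst j x ψ φ = φ := by
  unfold psubst
  induction φ with
  | atom n k y =>
    have : ¬ (n = 0 ∧ k = j) := fun h => hφ h.1
    simp [psubstAux, this]
  | neg φ ih => exact congrArg neg (ih hφ hd)
  | or φ χ ih₁ ih₂ =>
    rw [bv, Finset.disjoint_union_left] at hd
    exact congrArg₂ or (ih₁ hφ.1 hd.1) (ih₂ hφ.2 hd.2)
  | dia φ ih => exact congrArg dia (ih hφ hd)
  | ex u φ ih =>
    rw [bv, Finset.disjoint_insert_left] at hd
    have h : avoid ((φ.fv.erase u).image id ∪ (ψ.fv \ Finset.univ.image x)) u = u :=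
      avoid_of_notMem (by simp [hd.1])
    simp only [psubstAux, h]
    rw [show Function.update (id : ℕ → ℕ) u u = id from Function.update_eq_self u id,
      ih hφ hd.2]

theorem psubst_letter (j k : ℕ) (x : Fin 0 → ℕ) (ψ : QForm) :
    psubst j x ψ (atom 0 k Fin.elim0) = if k = j then ψ else atom 0 k Fin.elim0 := by
  by_cases h : k = j
  · have he : Function.extend x (fun i => id (Fin.elim0 (α := ℕ) i)) id = id :=
      funext fun i => Function.extend_apply' _ _ _ (by simp)
    simp only [psubst, psubstAux, h, and_self, dite_true, if_true]
    exact (congrArg (vsubst · ψ) he).trans (vsubst_id ψ)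
  · simp only [psubst, psubstAux, h, and_false, dite_false, if_false]
    exact congrArg (atom 0 k) (Subsingleton.elim _ _)

/-- The translation with an arbitrary choice of formulas for the letters. -/
def translWith (x : ℕ) (g : ℕ → QForm) : MForm → QForm
  | .letter p => g p
  | .neg φ => .neg (translWith x g φ)
  | .or φ ψ => .or (translWith x g φ) (translWith x g ψ)
  | .dia φ => .dia (translWith x g φ)
  | .ex φ => .ex x (translWith x g φ)

theorem transl_eq_translWith (x : ℕ) (s : ℕ → ℕ) (φ : MForm) :
    transl x s φ = translWith x (fun p => atom 1 (s p) fun _ => x) φ := by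
  induction φ <;> simp_all [transl, translWith]

theorem transl_subst_eq_translWith (x : ℕ) (s : ℕ → ℕ) (p : ℕ) (ψ φ : MForm) :
    transl x s (MForm.subst p ψ φ) =
      translWith x (fun q => transl x s (if q = p then ψ else .letter q)) φ := by
  induction φ <;> simp_all [transl, translWith, MForm.subst]

theorem fv_translWith {x : ℕ} {g : ℕ → QForm} (hg : ∀ p, (g p).fv ⊆ {x}) (φ : MForm) :
    (translWith x g φ).fv ⊆ {x} := by
  induction φ with
  | letter p => exact hg p
  | neg φ ih | dia φ ih => exact ih
  | or φ ψ ih₁ ih₂ => exact Finset.union_subset ih₁ ih₂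
  | ex φ ih => exact (Finset.erase_subset _ _).trans ih

theorem fv_transl (x : ℕ) (s : ℕ → ℕ) (φ : MForm) : (transl x s φ).fv ⊆ {x} := by
  rw [transl_eq_translWith]
  exact fv_translWith (fun p => by simp [fv]) φ

theorem psubst_translWith {x : ℕ} (g : ℕ → QForm) (j : ℕ) {ψ : QForm}
    (hψ : ψ.fv ⊆ {x}) (φ : MForm) :
    psubst j (fun _ : Fin 1 => x) ψ (translWith x g φ) =
      translWith x (fun p => psubst j (fun _ : Fin 1 => x) ψ (g p)) φ := by
  unfold psubst
  induction φ with
  | letter p => rfl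
  | neg φ ih => exact congrArg neg ih
  | or φ χ ih₁ ih₂ => exact congrArg₂ or ih₁ ih₂
  | dia φ ih => exact congrArg dia ih
  | ex φ ih =>
    have h : avoid (((translWith x g φ).fv.erase x).image id ∪
        (ψ.fv \ Finset.univ.image (fun _ : Fin 1 => x))) x = x :=
      avoid_of_notMem (by simp [Finset.sdiff_eq_empty_iff_subset.2 hψ])
    simp only [translWith, psubstAux, h]
    rw [show Function.update (id : ℕ → ℕ) x x = id from Function.update_eq_self x id, ih]

theorem psubst_atom_one (j k x : ℕ) (ψ : QForm) :
    psubst j (fun _ : Fin 1 => x) ψ (atom 1 k fun _ => x) =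
      if k = j then ψ else atom 1 k fun _ => x := by
  by_cases h : k = j
  · have he : Function.extend (fun _ : Fin 1 => x) (fun _ => id x) id = id := by
      funext i
      by_cases hi : ∃ k : Fin 1, (fun _ => x) k = i
      · obtain ⟨k, rfl⟩ := hi
        exact (Function.injective_of_subsingleton (fun _ : Fin 1 => x)).extend_apply _ _ k
      · exact Function.extend_apply' _ _ _ hi
    simp only [psubst, psubstAux, h, and_self, dite_true, if_true]
    exact (congrArg (vsubst · ψ) he).trans (vsubst_id ψ)
  · simp only [psubst, psubstAux, h, and_false, dite_false, if_false]
    rfl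

/-- Translations have no free variable but `x`, the variable substituted for, so nothing is renamed
and the equality is literal. Injectivity of `s` protects the other letters. -/
theorem transl_subst (x : ℕ) {s : ℕ → ℕ} (hs : Function.Injective s) (p : ℕ) (ψ φ : MForm) :
    transl x s (MForm.subst p ψ φ) =
      psubst (s p) (fun _ : Fin 1 => x) (transl x s ψ) (transl x s φ) := by
  rw [transl_subst_eq_translWith, transl_eq_translWith x s φ,
    psubst_translWith _ _ (fv_transl x s ψ)]
  congr 1
  funext q
  rw [psubst_atom_one]
  by_cases h : q = p
  · simp [h]
  · simp [h, hs.eq_iff, transl]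

end QForm

open QForm

/-- The axioms of the predicate calculus and the theorems of **K** are derivable from `G`. -/
def ExtendsQK (G : Set QForm) : Prop := ClassicalAx ∪ QForm.ofPForm '' logicK ⊆ QClosure G

namespace ExtendsQK

variable {G : Set QForm} {α β γ φ ψ : QForm} {x : ℕ}

theorem taut (hG : ExtendsQK G) (h : φ.IsTautology) : φ ∈ QClosure G := hG (.inl (.taut h))

theorem of_taut (hG : ExtendsQK G) (h : (imp α β).IsTautology) (hα : α ∈ QClosure G) :
    β ∈ QClosure G :=
  .mp hα (hG.taut h)

theorem of_taut₂ (hG : ExtendsQK G) (h : (imp α (imp β γ)).IsTautology) (hα : α ∈ QClosure G)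
    (hβ : β ∈ QClosure G) : γ ∈ QClosure G :=
  .mp hβ (.mp hα (hG.taut h))

theorem imp_trans (hG : ExtendsQK G) (h₁ : imp α β ∈ QClosure G) (h₂ : imp β γ ∈ QClosure G) :
    imp α γ ∈ QClosure G :=
  hG.of_taut₂ (fun v hn ho => by simp only [QForm.imp, hn, ho]; tauto) h₁ h₂

theorem imp_self (hG : ExtendsQK G) (α : QForm) : imp α α ∈ QClosure G :=
  hG.taut fun v hn ho => by simp only [QForm.imp, hn, ho]; tauto

theorem all_elim (hG : ExtendsQK G) (x : ℕ) (φ : QForm) : imp (all x φ) φ ∈ QClosure G := by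
  have h := hG (.inl (.allElim x x φ))
  rwa [show Function.update (id : ℕ → ℕ) x x = id from Function.update_eq_self x id,
    vsubst_id] at h

theorem ex_intro (hG : ExtendsQK G) (x : ℕ) (φ : QForm) : imp φ (ex x φ) ∈ QClosure G := by
  have h := hG (.inl (.exIntro x x φ))
  rwa [show Function.update (id : ℕ → ℕ) x x = id from Function.update_eq_self x id,
    vsubst_id] at h

theorem imp_all (hG : ExtendsQK G) (hx : x ∉ φ.fv) (h : imp φ ψ ∈ QClosure G) :
    imp φ (all x ψ) ∈ QClosure G :=
  .mp (.gen x h) (hG (.inl (.allDistrib x φ ψ hx)))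

theorem ex_imp (hG : ExtendsQK G) (hx : x ∉ φ.fv) (h : imp ψ φ ∈ QClosure G) :
    imp (ex x ψ) φ ∈ QClosure G :=
  .mp (.gen x h) (hG (.inl (.exDistrib x φ ψ hx)))

/-- The letters are replaced in increasing order. A formula `σ j` already put in place has no
letters, and its bound variables avoid the free variables of each later `σ i`, so later
substitutions leave it unchanged. -/
theorem inst_mem {σ : ℕ → QForm} {N : ℕ} {χ : PForm}
    (hχ : QForm.ofPForm χ ∈ QClosure G) (hN : (MForm.ofPForm χ).LettersLT N)
    (hσ : ∀ i < N, (σ i).NoLetter) (hd : ∀ j i, j < i → i < N → Disjoint (σ j).bv (σ i).fv) :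
    inst σ χ ∈ QClosure G := by
  suffices ∀ i ≤ N, inst (fun p => if p < i then σ p else atom 0 p Fin.elim0) χ ∈ QClosure G by
    have h := this N le_rfl
    rwa [inst_congr (τ := σ) (fun j hj => by simp [hj]) hN] at h
  intro i
  induction i with
  | zero => intro _; simpa [inst_letters] using hχ
  | succ i ih =>
    intro hi
    have h := QClosure.subst (m := 0) i Fin.elim0 (σ i) (fun a => a.elim0) (ih (by omega))
    rw [psubst_inst] at h
    change _ ∈ QClosure G at h
    convert h using 3 with p
    rcases lt_trichotomy p i with hp | rfl | hp
    · rw [if_pos (by omega), if_pos hp,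
        psubst_of_noLetter _ _ (hσ p (by omega)) (hd p i hp (by omega))]
    · simp [psubst_letter]
    · rw [if_neg (by omega), if_neg (by omega), psubst_letter, if_neg (by omega)]

/-- Letters `0` and `1` become `α` and `β`. -/
theorem inst_pair_mem {χ : PForm} (hχ : QForm.ofPForm χ ∈ QClosure G)
    (hN : (MForm.ofPForm χ).LettersLT 2) (hα : α.NoLetter) (hβ : β.NoLetter)
    (hd : Disjoint α.bv β.fv) :
    inst (fun i => if i = 0 then α else β) χ ∈ QClosure G := by
  refine inst_mem hχ hN (fun i _ => by split_ifs <;> assumption) fun j i h h' => ?_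
  obtain ⟨rfl, rfl⟩ : j = 0 ∧ i = 1 := by omega
  simpa using hd

theorem box_mono (hG : ExtendsQK G) (hφ : φ.NoLetter) (hψ : ψ.NoLetter)
    (hd : Disjoint φ.bv ψ.fv) (h : imp φ ψ ∈ QClosure G) : imp (box φ) (box ψ) ∈ QClosure G :=
  .mp (.nec h) (inst_pair_mem (hG (.inr ⟨_, .base (.inr (.inl rfl)), rfl⟩))
    (by simp [PForm.imp, PForm.box, MForm.ofPForm, MForm.LettersLT]) hφ hψ hd)

theorem box_mono' (hG : ExtendsQK G) (hφ : φ.NoLetter) (hψ : ψ.NoLetter)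
    (hd : Disjoint ψ.bv φ.fv) (h : imp φ ψ ∈ QClosure G) : imp (box φ) (box ψ) ∈ QClosure G := by
  have h₀ : PForm.imp (.box (.imp (.letter 0) (.letter 1)))
      (.imp (.box (.letter 0)) (.box (.letter 1))) ∈ logicK := .base (.inr (.inl rfl))
  have hK : PForm.imp (.box (.imp (.letter 1) (.letter 0)))
      (.imp (.box (.letter 1)) (.box (.letter 0))) ∈ logicK :=
    -- The letters are exchanged so that `ψ` is substituted before `φ`, which reverses the
    -- disjointness condition of `box_mono`.
    PClosure.subst 2 (.letter 0) (PClosure.subst 0 (.letter 1) (PClosure.subst 1 (.letter 2) h₀))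
  exact .mp (.nec h) (inst_pair_mem (hG (.inr ⟨_, hK, rfl⟩))
    (by simp [PForm.imp, PForm.box, MForm.ofPForm, MForm.LettersLT]) hψ hφ hd)

theorem dia_mono (hG : ExtendsQK G) (hφ : φ.NoLetter) (hψ : ψ.NoLetter)
    (hd : Disjoint φ.bv ψ.fv) (h : imp φ ψ ∈ QClosure G) : imp (dia φ) (dia ψ) ∈ QClosure G := by
  have hdual : ∀ {α : QForm}, α.NoLetter →
      QForm.and (imp (dia α) (neg (box (neg α)))) (imp (neg (box (neg α))) (dia α)) ∈ QClosure G :=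
    fun {α} hα => inst_mem (σ := fun _ => α) (N := 1)
      (hG (.inr ⟨_, .base (.inr (.inr rfl)), rfl⟩))
      (by simp [PForm.imp, PForm.box, PForm.iff, PForm.and, MForm.ofPForm, MForm.LettersLT])
      (fun _ _ => hα) (fun _ _ _ _ => by omega)
  have h₁ : imp (box (neg ψ)) (box (neg φ)) ∈ QClosure G :=
    hG.box_mono' hψ hφ hd (hG.of_taut (fun v hn ho => by simp only [QForm.imp, hn, ho]; tauto) h)
  refine .mp h₁ (hG.of_taut₂ (fun v hn ho => ?_) (hdual hφ) (hdual hψ))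
  simp only [QForm.imp, QForm.and, hn, ho]
  tauto

/-- The formulas with derivable translations are closed under the rules of monadic logics. -/
theorem transl_mem_of_mclosure {s : ℕ → ℕ} (hs : Function.Injective s)
    {M : Set MForm} (hM : ∀ φ ∈ M, transl x s φ ∈ QClosure G) {φ : MForm} (h : φ ∈ MClosure M) :
    transl x s φ ∈ QClosure G := by
  induction h with
  | base h' => exact hM _ h'
  | mp _ _ ih₁ ih₂ => exact .mp ih₁ ih₂
  | boxNec _ ih => exact .nec ih
  | allNec _ ih => exact .gen x ih
  | subst p ψ _ ih =>
    rw [transl_subst x hs]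
    exact .subst _ _ _ (Function.injective_of_subsingleton _) ih

theorem transl_ofPForm_mem {s : ℕ → ℕ} {χ : PForm} (hχ : QForm.ofPForm χ ∈ QClosure G) :
    transl x s (MForm.ofPForm χ) ∈ QClosure G := by
  obtain ⟨N, hN⟩ := MForm.exists_lettersLT (MForm.ofPForm χ)
  have h := inst_mem (σ := fun p => atom 1 (s p) fun _ => x) hχ hN
    (fun _ _ => Nat.one_ne_zero) (fun _ _ _ _ => Finset.disjoint_empty_left _)
  convert h using 1
  clear hN h hχ
  induction χ <;> simp_all [inst, MForm.ofPForm, transl]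

theorem transl_s5Ax_mem (hG : ExtendsQK G) {s : ℕ → ℕ} {φ : MForm} (h : φ ∈ MForm.s5Ax) :
    transl x s φ ∈ QClosure G := by
  set p : QForm := atom 1 (s 0) fun _ => x
  set q : QForm := atom 1 (s 1) fun _ => x
  have hx : ∀ α, x ∉ (ex x α).fv := fun α => by simp [fv]
  have hx' : ∀ α, x ∉ (all x α).fv := fun α => by simp [fv, all]
  rcases h with rfl | rfl | rfl | rfl | rfl
  · change imp (all x (imp p q)) (imp (all x p) (all x q)) ∈ QClosure G
    have h : imp (QForm.and (all x (imp p q)) (all x p)) q ∈ QClosure G :=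
      hG.of_taut₂ (fun v hn ho => by simp only [QForm.imp, QForm.and, hn, ho]; tauto)
        (hG.all_elim x (imp p q)) (hG.all_elim x p)
    refine hG.of_taut (fun v hn ho => by simp only [QForm.imp, QForm.and, hn, ho]; tauto)
      (hG.imp_all (x := x) ?_ h)
    simp [fv, QForm.and, all]
  · change QForm.and (imp (ex x p) (neg (all x (neg p)))) (imp (neg (all x (neg p))) (ex x p))
      ∈ QClosure G
    have h₁ : imp (ex x p) (ex x (neg (neg p))) ∈ QClosure G :=
      hG.ex_imp (hx _) (hG.imp_trans
        (hG.taut fun v hn ho => by simp only [QForm.imp, hn, ho]; tauto) (hG.ex_intro _ _))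
    have h₂ : imp (ex x (neg (neg p))) (ex x p) ∈ QClosure G :=
      hG.ex_imp (hx _) (hG.imp_trans
        (hG.taut fun v hn ho => by simp only [QForm.imp, hn, ho]; tauto) (hG.ex_intro _ _))
    exact hG.of_taut₂ (fun v hn ho => by simp only [QForm.imp, QForm.and, all, hn, ho]; tauto)
      h₁ h₂
  · exact hG.ex_intro x p
  · exact hG.ex_imp (hx _) (hG.imp_self _)
  · exact hG.imp_all (hx _) (hG.imp_self _)

theorem transl_connecting_mem (hG : ExtendsQK G) {s : ℕ → ℕ} :
    transl x s MForm.connecting ∈ QClosure G :=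
  hG.ex_imp (by simp [fv, transl]) (hG.dia_mono (φ := atom 1 (s 0) fun _ => x) Nat.one_ne_zero
    Nat.one_ne_zero (Finset.disjoint_empty_left _) (hG.ex_intro _ _))

theorem all_rename (hG : ExtendsQK G) (k x y : ℕ) :
    imp (all x (atom 1 k fun _ => x)) (all y (atom 1 k fun _ => y)) ∈ QClosure G := by
  refine hG.imp_all (by simp [fv, all]) ?_
  have h := hG (.inl (.allElim x y (atom 1 k fun _ => x)))
  rwa [vsubst, show Function.update id x y ∘ (fun _ : Fin 1 => x) = fun _ => y by
    funext; simp] at h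

/-- The axiom is given with bound variable `0`, its translation has `x`. Instances with different
bound variables are not identified, so the change is derived. In `F y z` the free variable `y` and
the bound variable `z` are separate, and `F x x` passes to `F 0 x` by instantiation and then to `F 0
0` by renaming. -/
theorem transl_plusFormula_mem (hG : ExtendsQK G) {s : ℕ → ℕ}
    (h : QForm.plusFormula ∈ QClosure G) : transl x s MForm.plusFormula ∈ QClosure G := by
  have h₀ : transl 0 s MForm.plusFormula ∈ QClosure G := by
    have h' : translWith 0 (fun _ => atom 1 0 fun _ => 0) MForm.plusFormula ∈ QClosure G := h
    have h'' := QClosure.subst (m := 1) 0 (fun _ => 0) (atom 1 (s 0) fun _ => 0)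
      (Function.injective_of_subsingleton _) h'
    rw [psubst_translWith _ _ (by simp [fv])] at h''
    simp only [psubst_atom_one, if_true] at h''
    exact h''
  rcases eq_or_ne x 0 with rfl | hx
  · exact h₀
  let P : ℕ → QForm := fun y => atom 1 (s 0) fun _ => y
  let A : ℕ → QForm := fun y => box (all y (P y))
  let F : ℕ → ℕ → QForm := fun y z => imp (box (imp (box (P y)) (A z))) (A z)
  have hA : ∀ y z, imp (A y) (A z) ∈ QClosure G := fun y z =>
    hG.box_mono Nat.one_ne_zero Nat.one_ne_zero (by simp [fv, P, all]) (hG.all_rename _ y z)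
  have hF : imp (F 0 x) (F 0 0) ∈ QClosure G := by
    have h₁ : imp (box (imp (box (P 0)) (A 0))) (box (imp (box (P 0)) (A x))) ∈ QClosure G := by
      -- Only this order of substitution works: `0` is bound in the first formula and free in the
      -- second, while `x`, bound in the second, is not free in the first.
      refine hG.box_mono' ?_ ?_ ?_ (hG.of_taut ?_ (hA 0 x))
      · simp [NoLetter, QForm.imp, box, A, P, all]
      · simp [NoLetter, QForm.imp, box, A, P, all]
      · simpa [bv, fv, QForm.imp, box, A, P, all] using hx
      · exact fun v hn ho => by simp only [QForm.imp, hn, ho]; tauto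
    exact hG.of_taut₂ (fun v hn ho => by simp only [F, QForm.imp, hn, ho]; tauto) h₁ (hA x 0)
  have hall : imp (all x (F x x)) (all 0 (F 0 0)) ∈ QClosure G := by
    refine hG.imp_all (by simp [fv, QForm.imp, box, all, F, A, P]) (hG.imp_trans ?_ hF)
    have h := hG (.inl (.allElim x 0 (F x x)))
    convert h using 2
    have hz : avoid ((((P x).neg).fv.erase x).image (Function.update id x 0)) x = x :=
      avoid_of_notMem (by simp [fv, P])
    simp [F, A, P, QForm.imp, box, all, vsubst, hz]
    constructor <;> funext <;> simp
  have hbox : imp (box (all x (F x x))) (box (all 0 (F 0 0))) ∈ QClosure G :=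
    hG.box_mono (by simp [NoLetter, QForm.imp, box, A, P, all, F])
      (by simp [NoLetter, QForm.imp, box, A, P, all, F])
      (by simp [fv, QForm.imp, box, A, P, all, F]) hall
  exact hG.imp_trans (hG.imp_trans hbox h₀) (hA 0 x)

theorem transl_mem_of_monadicExt (hG : ExtendsQK G) {s : ℕ → ℕ} (hs : Function.Injective s)
    {L : Set PForm} (hL : QForm.ofPForm '' L ⊆ QClosure G) {φ : MForm} (h : φ ∈ monadicExt L) :
    transl x s φ ∈ QClosure G := by
  refine transl_mem_of_mclosure hs ?_ h
  rintro φ ((⟨χ, hχ, rfl⟩ | h) | rfl)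
  · exact transl_ofPForm_mem (hL ⟨χ, hχ, rfl⟩)
  · exact hG.transl_s5Ax_mem h
  · exact hG.transl_connecting_mem

end ExtendsQK

theorem transl_mem_QGL (x : ℕ) {s : ℕ → ℕ} (hs : Function.Injective s) {φ : MForm}
    (h : φ ∈ MGL) : transl x s φ ∈ QGL := by
  have hG : ExtendsQK (ClassicalAx ∪ QForm.ofPForm '' logicGL) := by
    rintro φ (h | ⟨χ, hχ, rfl⟩)
    · exact .base (.inl h)
    · exact .base (.inr ⟨χ, .base (.inr hχ), rfl⟩)
  exact hG.transl_mem_of_monadicExt hs (fun _ h => .base (.inr h)) h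

theorem transl_mem_QPlusGrz (x : ℕ) {s : ℕ → ℕ} (hs : Function.Injective s) {φ : MForm}
    (h : φ ∈ MPlusGrz) : transl x s φ ∈ QPlusGrz := by
  have hG : ExtendsQK (insert QForm.plusFormula (predicateExt logicGrz)) := by
    rintro φ (h | ⟨χ, hχ, rfl⟩)
    · exact .base (.inr (.base (.inl h)))
    · exact .base (.inr (.base (.inr ⟨χ, .base (.inr (.base (.inl hχ))), rfl⟩)))
  refine ExtendsQK.transl_mem_of_mclosure hs ?_ h
  rintro φ (rfl | h)
  · exact hG.transl_plusFormula_mem (.base (.inl rfl))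
  · exact hG.transl_mem_of_monadicExt hs (fun _ h => .base (.inr (.base (.inr h)))) h

end MonadicModal

theorem mainTheorem8 (x : ℕ) (s : ℕ → ℕ) (hs : Function.Injective s) :
    MonadicModal.IsMonadicFragment x s MonadicModal.MGL MonadicModal.QGL ∧
    MonadicModal.IsMonadicFragment x s MonadicModal.MPlusGrz MonadicModal.QPlusGrz :=
  ⟨fun _ => ⟨MonadicModal.transl_mem_QGL x hs, MonadicModal.mem_MGL_of_transl_mem x hs⟩,
    fun _ => ⟨MonadicModal.transl_mem_QPlusGrz x hs,
      MonadicModal.mem_MPlusGrz_of_transl_mem x hs⟩⟩
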